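/- **Setting.** Consider a $K$-user MIMO interference channel with $N_t$ transmit antennas, $N_r$ receive antennas and $d$ streams per user. Let $\hat{\mathbf H}_{ki}\in\mathbb C^{N_r\times N_t}$ be the known channel estimates, $\mathbf\Sigma_t,\mathbf\Sigma_r$ positive semidefinite antenna correlation matrices, $\mathbf v_i^{(j)}\in\mathbb C^{N_t}$ and $\mathbf u_k^{(m)}\in\mathbb C^{N_r}$ fixed transmit and receive beams of unit norm, $\sigma^2>0$ the noise variance and $\sigma_h^2\ge 0$. The channel errors are $\mathbf E_{ki}=\mathbf\Sigma_r^{1/2}\mathbf H^{(w)}_{ki}\mathbf\Sigma_t^{1/2}$, where $\mathrm{vec}(\mathbf H^{(w)}_{ki})\sim\mathcal{CN}(\mathbf 0,\sigma_h^2\mathbf I)$ (circularly symmetric), and the $\mathbf E_{ki}$ are independent across the pairs $(k,i)$. Fix a user $k$, a stream $m$ and a target rate $R>0$, and put $$\mathsf{SINR}=\frac{|\mathbf u_k^{(m)H}\hat{\mathbf H}_{kk}\mathbf v_k^{(m)}|^2}{|\mathbf u_k^{(m)H}\mathbf E_{kk}\mathbf v_k^{(m)}|^2+\sum_{j\ne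 m}|\mathbf u_k^{(m)H}(\hat{\mathbf H}_{kk}+\mathbf E_{kk})\mathbf v_k^{(j)}|^2+\sum_{i\neq k}\sum_{j=1}^d|\mathbf u_k^{(m)H}(\hat{\mathbf H}_{ki}+\mathbf E_{ki})\mathbf v_i^{(j)}|^2+\sigma^2},$$ $$\tau=\frac{|\mathbf u_k^{(m)H}\hat{\mathbf H}_{kk}\mathbf v_k^{(m)}|^2}{2^{R}-1}-\sigma^2 .$$ Let $\mathbf X$ be the random vector of size $Kd$ whose entry with index $(i,j)$ is $\mathbf u_k^{(m)H}\mathbf E_{kk}\mathbf v_k^{(m)}$ if $(i,j)=(k,m)$, and $\mathbf u_k^{(m)H}(\hat{\mathbf H}_{ki}+\mathbf E_{ki})\mathbf v_i^{(j)}$ otherwise. Let $\boldsymbol\mu=\mathbb E\,\mathbf X$ and $\mathbf\Sigma=\mathbb E\,(\mathbf X-\boldsymbol\mu)(\mathbf X-\boldsymbol\mu)^H$. **Theorem.** Assume that $\tau\ge 0$ and that $\mathbf\Sigma$ is nonsingular. Let $\mathbf\Sigma=\mathbf\Psi\mathbf\Lambda\mathbf\Psi^H$ be any eigendecomposition ($\mathbf\Psi$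 unitary, $\mathbf\Lambda$ real diagonal), let $\lambda_1,\dots,\lambda_\kappa$ be the distinct eigenvalues of $\mathbf\Sigma$, with multiplicities $\kappa_1,\dots,\kappa_\kappa$, let $\boldsymbol\chi=\mathbf\Lambda^{-1/2}\mathbf\Psi^H\boldsymbol\mu$, and let $\chi_i^{(1)},\dots,\chi_i^{(\kappa_i)}$ be the entries of $\boldsymbol\chi$ that belong to $\lambda_i$. For complex $s$ put $$g_i(s)=\frac{e^{\tau s}}{s-1/\lambda_i}\cdot\frac{\exp\Big(-\sum_{p\ne i}\frac{(s-1/\lambda_i)\lambda_p}{1+(s-1/\lambda_i)\lambda_p}\sum_{q=1}^{\kappa_p}|\chi_p^{(q)}|^2\Big)}{\prod_{p\neq i}\big(1+(s-1/\lambda_i)\lambda_p\big)^{\kappa_p}} .$$ Then the infinite series below converge absolutely, and the outage probability is $$\Pr\{\log_2(1+\mathsf{SINR})\le R\}=-\sum_{i=1}^{\kappa}\frac{e^{-\left(\frac{\tau}{\lambda_i}+\sum_{j=1}^{\kappa_i}|\chi_i^{(j)}|^2\right)}}{\lambda_i^{\kappa_i}}\sum_{n=\kappa_i-1}^{\infty}\frac{1}{n!}\,g_i^{(n)}(0)\,\frac{1}{(n-\kappa_i+1)!}\left(\frac{\sum_{j=1}^{\kappa_i}|\chi_i^{(j)}|^2}{\lambda_i}\right)^{n-\kappa_i+1},$$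 where $g_i^{(n)}$ is the $n$-th derivative of $g_i$ and $0^0=1$. -/

import Mathlib

open MeasureTheory ProbabilityTheory
open scoped NNReal ComplexOrder MatrixOrder Matrix

/-- The circularly-symmetric complex Gaussian law `CN(0, v)` on `ℂ`: real and imaginary parts are
independent real Gaussians with mean `0` and variance `v / 2`. -/
noncomputable def circularGaussian (v : ℝ≥0) : Measure ℂ :=
  ((gaussianReal 0 (v / 2)).prod (gaussianReal 0 (v / 2))).map
    (fun p : ℝ × ℝ => (⟨p.1, p.2⟩ : ℂ))

/-- The (deterministic) data of a `K`-user MIMO interference channel with `d` streams per user,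
`Nt` transmit and `Nr` receive antennas. -/
structure InterferenceChannel (K d Nt Nr : ℕ) where
  /-- `Hhat k i`: the available channel state from transmitter `i` to receiver `k`. -/
  Hhat : Fin K → Fin K → Matrix (Fin Nr) (Fin Nt) ℂ
  /-- Transmit antenna correlation matrix. -/
  Sigmat : Matrix (Fin Nt) (Fin Nt) ℂ
  /-- Receive antenna correlation matrix. -/
  Sigmar : Matrix (Fin Nr) (Fin Nr) ℂ
  /-- Transmit beamforming matrices. -/
  V : Fin K → Matrix (Fin Nt) (Fin d) ℂ
  /-- Receive beamforming matrices. -/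
  U : Fin K → Matrix (Fin Nr) (Fin d) ℂ
  /-- Noise variance `σ²`. -/
  noiseVar : ℝ
  /-- Variance `σ_h²` of the entries of the channel error before correlation. -/
  errVar : ℝ≥0

namespace InterferenceChannel

variable {K d Nt Nr : ℕ} (S : InterferenceChannel K d Nt Nr) {Ω : Type*}

/-- The transmit beam `v_i^(j)`. -/
def v (i : Fin K) (j : Fin d) : Fin Nt → ℂ := fun a => S.V i a j

/-- The receive beam `u_k^(m)`. -/
def u (k : Fin K) (m : Fin d) : Fin Nr → ℂ := fun a => S.U k a m

/-- All transmit and receive beams have Euclidean norm one. -/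
def NormalizedBeams : Prop :=
  (∀ i j, ‖WithLp.toLp 2 (S.v i j)‖ = 1) ∧ (∀ k m, ‖WithLp.toLp 2 (S.u k m)‖ = 1)

/-- The CSI error `E_ki = Σ_r^{1/2} W_ki Σ_t^{1/2}` (positive semidefinite square roots). -/
noncomputable def err (W : Fin K → Fin K → Ω → Matrix (Fin Nr) (Fin Nt) ℂ)
    (k i : Fin K) (ω : Ω) : Matrix (Fin Nr) (Fin Nt) ℂ :=
  CFC.sqrt S.Sigmar * W k i ω * CFC.sqrt S.Sigmat

/-- The Kronecker CSI error model: every `vec(W_ki)` is `CN(0, σ_h² I)`, and the errors `E_ki` are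
independent across the transmitter-receiver pairs `(k, i)`. -/
def KroneckerErrorModel [MeasurableSpace Ω] (P : Measure Ω)
    (W : Fin K → Fin K → Ω → Matrix (Fin Nr) (Fin Nt) ℂ) : Prop :=
  (∀ k i, HasLaw (fun ω => (W k i ω).vec)
    (Measure.pi (fun _ : Fin Nt × Fin Nr => circularGaussian S.errVar)) P) ∧
  iIndepFun (fun (q : Fin K × Fin K) (ω : Ω) => (S.err W q.1 q.2 ω).vec) P

/-- The desired signal power `|u_k^(m)ᴴ Ĥ_kk v_k^(m)|²`. -/
noncomputable def signalPower (k : Fin K) (m : Fin d) : ℝ :=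
  ‖star (S.u k m) ⬝ᵥ (S.Hhat k k *ᵥ S.v k m)‖ ^ 2

/-- The SINR of stream `m` of user `k`. The terms of the denominator are the interference purely by
channel uncertainty, the inter-stream interference, the other-user interference and the noise. -/
noncomputable def sinr (W : Fin K → Fin K → Ω → Matrix (Fin Nr) (Fin Nt) ℂ)
    (k : Fin K) (m : Fin d) (ω : Ω) : ℝ :=
  S.signalPower k m /
    (‖star (S.u k m) ⬝ᵥ (S.err W k k ω *ᵥ S.v k m)‖ ^ 2
      + ∑ j ∈ Finset.univ.erase m,
          ‖star (S.u k m) ⬝ᵥ ((S.Hhat k k + S.err W k k ω) *ᵥ S.v k j)‖ ^ 2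
      + ∑ i ∈ Finset.univ.erase k, ∑ j : Fin d,
          ‖star (S.u k m) ⬝ᵥ ((S.Hhat k i + S.err W k i ω) *ᵥ S.v i j)‖ ^ 2
      + S.noiseVar)

/-- The outage probability of stream `m` of user `k` at target rate `R`. -/
noncomputable def outageProb [MeasurableSpace Ω] (P : Measure Ω)
    (W : Fin K → Fin K → Ω → Matrix (Fin Nr) (Fin Nt) ℂ)
    (k : Fin K) (m : Fin d) (R : ℝ) : ℝ :=
  P.real {ω | Real.logb 2 (1 + S.sinr W k m ω) ≤ R}

/-- The threshold `τ`. -/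
noncomputable def tau (k : Fin K) (m : Fin d) (R : ℝ) : ℝ :=
  S.signalPower k m / ((2 : ℝ) ^ R - 1) - S.noiseVar

/-- The random vector `X_k^(m)`, of size `K d`. -/
noncomputable def X (W : Fin K → Fin K → Ω → Matrix (Fin Nr) (Fin Nt) ℂ)
    (k : Fin K) (m : Fin d) (ω : Ω) : Fin K × Fin d → ℂ := fun a =>
  if a.1 = k ∧ a.2 = m then
    star (S.u k m) ⬝ᵥ (S.err W k k ω *ᵥ S.v k m)
  else
    star (S.u k m) ⬝ᵥ ((S.Hhat k a.1 + S.err W k a.1 ω) *ᵥ S.v a.1 a.2)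

/-- The mean vector of `X_k^(m)`. -/
noncomputable def mean [MeasurableSpace Ω] (P : Measure Ω)
    (W : Fin K → Fin K → Ω → Matrix (Fin Nr) (Fin Nt) ℂ)
    (k : Fin K) (m : Fin d) : Fin K × Fin d → ℂ := fun a =>
  ∫ ω, S.X W k m ω a ∂P

/-- The covariance matrix of `X_k^(m)`. -/
noncomputable def cov [MeasurableSpace Ω] (P : Measure Ω)
    (W : Fin K → Fin K → Ω → Matrix (Fin Nr) (Fin Nt) ℂ)
    (k : Fin K) (m : Fin d) : Matrix (Fin K × Fin d) (Fin K × Fin d) ℂ :=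
  Matrix.of fun a b =>
    ∫ ω, (S.X W k m ω a - S.mean P W k m a) * star (S.X W k m ω b - S.mean P W k m b) ∂P

end InterferenceChannel

namespace OutageSeries

variable {ι : Type*} [Fintype ι]

/-- The set of distinct values of the diagonal `Λ` of an eigendecomposition. -/
noncomputable def distinct (Λ : ι → ℝ) : Finset ℝ := Finset.univ.image Λ

/-- The multiplicity of the eigenvalue `l`. -/
noncomputable def mult (Λ : ι → ℝ) (l : ℝ) : ℕ := (Finset.univ.filter (fun a => Λ a = l)).card

/-- The vector `χ = Λ^{-1/2} Ψᴴ μ`. -/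
noncomputable def chi (Ψ : Matrix ι ι ℂ) (Λ : ι → ℝ) (μ : ι → ℂ) : ι → ℂ := fun a =>
  (((√(Λ a))⁻¹ : ℝ) : ℂ) * (Ψᴴ *ᵥ μ) a

/-- `∑_j |χ^(j)|²` over the entries of `χ` that belong to the eigenvalue `l`. -/
noncomputable def energy (Λ : ι → ℝ) (χ : ι → ℂ) (l : ℝ) : ℝ :=
  ∑ a ∈ Finset.univ.filter (fun a => Λ a = l), ‖χ a‖ ^ 2

/-- The function `g_i` attached to the eigenvalue `l = λ_i`. -/
noncomputable def g (τ : ℝ) (Λ : ι → ℝ) (χ : ι → ℂ) (l : ℝ) (s : ℂ) : ℂ :=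
  Complex.exp (τ * s) / (s - 1 / l) *
    (Complex.exp (-∑ p ∈ (distinct Λ).erase l,
        (s - 1 / l) * p / (1 + (s - 1 / l) * p) * energy Λ χ p) /
      ∏ p ∈ (distinct Λ).erase l, (1 + (s - 1 / l) * p) ^ mult Λ p)

/-- The summand with index `n = κ_i - 1 + r`, `r ≥ 0`, of the series attached to `l = λ_i`. -/
noncomputable def term (τ : ℝ) (Λ : ι → ℝ) (χ : ι → ℂ) (l : ℝ) (r : ℕ) : ℂ :=
  1 / ((mult Λ l - 1 + r).factorial : ℂ) * iteratedDeriv (mult Λ l - 1 + r) (g τ Λ χ l) 0 *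
    (1 / (r.factorial : ℂ)) * ((energy Λ χ l / l : ℝ) : ℂ) ^ r

end OutageSeries

/-! ### Cauchy integrals over circles and decomposition into principal parts. -/

section CauchyTransform

open Filter Topology Metric

/-! Write Q for the sum of the |X_a|². The SINR is the signal power divided by Q + σ², so outage is
the event Q ≥ τ, and a tail of Q has to be computed. The error part of X is a centred circular
Gaussian vector. Applying Ψᴴ preserves norms and makes its coordinates independent, so the
characteristic function of Q at t is F(-it), where F = `laplace` is a product of factors
exp(-sλ|χ|²/(1+sλ))/(1+sλ) (`charFun_sum_norm_sq`).

F is holomorphic off the points -1/λ, where its singularities are essential as soon as some χ there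
is nonzero, and it tends to 0 at infinity. Subtracting all principal parts leaves an entire function
vanishing at infinity, which is zero by Liouville; so F is minus a sum of Cauchy integrals over
small circles around the -1/λ (`eq_neg_sum_cauchyTransform`). These circles lie in Re z < 0, where
-1/(z-s) is the integral of e^{(z-s)x} over x > 0 for s on the imaginary axis. Hence F(-it) is the
Fourier transform of φ(x) = ∑ (2πi)⁻¹∮F(z)e^{zx}dz on x > 0, and uniqueness of characteristic
functions makes φ the density of Q. Integrating φ over (τ,∞) gives -∑ (2πi)⁻¹∮F(z)e^{τz}/z dz
(`integral_Ioi_exp_mul_circleExp`).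

The substitution z = w - 1/λ_i splits the integrand into a constant, the holomorphic g_i(w), and
exp(b/w)/w^κ_i with b = ∑|χ_i|²/λ_i (`laplace_mul_exp_div_eq`). Expanding exp(b/w) in powers of 1/w
and applying Cauchy's formula for derivatives termwise gives the series
(`hasSum_circleIntegral_mul_exp_div`). -/

/-- The Cauchy transform of `f` along the circle of centre `p` and radius `r`. -/
noncomputable def cauchyTransform (f : ℂ → ℂ) (p : ℂ) (r : ℝ) (s : ℂ) : ℂ :=
  (2 * Real.pi * Complex.I)⁻¹ * ∮ z in C(p, r), f z / (z - s)

/-- Differentiation under the integral sign: points within δ/2 of s stay at distance at least δ/2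
from the circle, which bounds the differentiated kernel uniformly. Points inside and outside the
circle are both covered. -/
theorem differentiableAt_cauchyTransform {f : ℂ → ℂ} {p s : ℂ} {r : ℝ} (hr : 0 < r)
    (hf : ContinuousOn f (sphere p r)) (hs : s ∉ sphere p r) :
    DifferentiableAt ℂ (cauchyTransform f p r) s := by
  obtain ⟨δ, hδ, hball⟩ : ∃ δ > 0, ball s δ ⊆ (sphere p r)ᶜ :=
    Metric.isOpen_iff.1 isClosed_sphere.isOpen_compl s hs
  have hcf : Continuous fun θ : ℝ => f (circleMap p r θ) :=
    hf.comp_continuous (continuous_circleMap p r) fun θ => circleMap_mem_sphere p hr.le θ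
  have hfar : ∀ θ : ℝ, ∀ x ∈ ball s (δ / 2), δ / 2 ≤ ‖circleMap p r θ - x‖ := by
    intro θ x hx
    by_contra! h
    refine hball (a := circleMap p r θ) ?_ (circleMap_mem_sphere p hr.le θ)
    rw [mem_ball] at hx ⊢
    have := dist_triangle (circleMap p r θ) x s
    rw [← dist_eq_norm] at h
    linarith
  have hne : ∀ θ : ℝ, ∀ x ∈ ball s (δ / 2), circleMap p r θ - x ≠ 0 := fun θ x hx h0 => by
    have := hfar θ x hx
    rw [h0, norm_zero] at this
    linarith
  have hss : s ∈ ball s (δ / 2) := mem_ball_self (by positivity)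
  have hcont : ∀ x ∈ ball s (δ / 2), ∀ n : ℕ, Continuous fun θ : ℝ =>
      deriv (circleMap p r) θ • (f (circleMap p r θ) / (circleMap p r θ - x) ^ n) := by
    intro x hx n
    simp only [deriv_circleMap]
    refine (by fun_prop : Continuous fun θ : ℝ => circleMap 0 r θ * Complex.I).smul
      (hcf.div (by fun_prop) fun θ => pow_ne_zero _ (hne θ x hx))
  have key := intervalIntegral.hasDerivAt_integral_of_dominated_loc_of_deriv_le
    (μ := volume) (a := 0) (b := 2 * Real.pi) (x₀ := s) (s := ball s (δ / 2))
    (F := fun x θ => deriv (circleMap p r) θ • (f (circleMap p r θ) / (circleMap p r θ - x)))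
    (F' := fun x θ => deriv (circleMap p r) θ • (f (circleMap p r θ) / (circleMap p r θ - x) ^ 2))
    (bound := fun θ => r * (‖f (circleMap p r θ)‖ / (δ / 2) ^ 2))
    (ball_mem_nhds s (by positivity))
    (by
      filter_upwards [ball_mem_nhds s (by positivity : 0 < δ / 2)] with x hx
      simpa using (hcont x hx 1).aestronglyMeasurable)
    (by simpa using (hcont s hss 1).intervalIntegrable _ _)
    (hcont s hss 2).aestronglyMeasurable
    (by
      refine Eventually.of_forall fun θ _ x hx => ?_
      have := hfar θ x hx
      rw [norm_smul, norm_div, norm_pow, deriv_circleMap, norm_mul, Complex.norm_I, mul_one,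
        norm_circleMap_zero, abs_of_pos hr]
      gcongr)
    ((continuous_const.mul (hcf.norm.div_const _)).intervalIntegrable _ _)
    (by
      refine Eventually.of_forall fun θ _ x hx => ?_
      have h1 : HasDerivAt (fun x => circleMap p r θ - x) (-1) x := by
        simpa using (hasDerivAt_id x).const_sub (circleMap p r θ)
      have h2 := ((h1.inv (hne θ x hx)).const_mul (f (circleMap p r θ))).const_smul
        (deriv (circleMap p r) θ)
      convert! h2 using 1
      simp [div_eq_mul_inv])
  exact (key.2.differentiableAt).const_mul _

theorem norm_cauchyTransform_le {f : ℂ → ℂ} {p s : ℂ} {r C : ℝ} (hr : 0 ≤ r)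
    (hC : ∀ z ∈ sphere p r, ‖f z‖ ≤ C) (hs : r < ‖s - p‖) :
    ‖cauchyTransform f p r s‖ ≤ r * (C / (‖s - p‖ - r)) := by
  refine circleIntegral.norm_two_pi_i_inv_smul_integral_le_of_norm_le_const (f := fun z =>
    f z / (z - s)) hr fun z hz => ?_
  rw [norm_div]
  have h1 : ‖s - p‖ - r ≤ ‖z - s‖ := by
    have h2 : ‖s - p‖ ≤ ‖s - z‖ + ‖z - p‖ := norm_sub_le_norm_sub_add_norm_sub s z p
    rw [mem_sphere, dist_eq_norm] at hz
    rw [norm_sub_rev z s]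
    linarith
  have h3 := hC z hz
  have h4 : 0 ≤ C := (norm_nonneg _).trans h3
  gcongr

theorem tendsto_cauchyTransform_cocompact {f : ℂ → ℂ} {p : ℂ} {r : ℝ} (hr : 0 ≤ r)
    (hf : ContinuousOn f (sphere p r)) :
    Tendsto (cauchyTransform f p r) (cocompact ℂ) (𝓝 0) := by
  obtain ⟨C, hC⟩ := (isCompact_sphere p r).exists_bound_of_continuousOn hf
  have hinf : Tendsto (fun s : ℂ => ‖s - p‖) (cocompact ℂ) atTop := by
    simpa only [dist_eq_norm] using tendsto_dist_right_cocompact_atTop p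
  refine squeeze_zero_norm' (a := fun s => r * (C / (‖s - p‖ - r))) ?_ ?_
  · filter_upwards [hinf.eventually_gt_atTop r] with s hs
    exact norm_cauchyTransform_le hr hC hs
  · simpa [sub_eq_add_neg] using ((tendsto_const_nhds (x := C)).div_atTop
      (tendsto_atTop_add_const_right _ (-r) hinf)).const_mul r

/-- Cauchy's integral formula on an annulus. The difference quotient of f at s has a removable
singularity there, so its integrals over the two circles agree; the leftover integral of 1/(z-s) is
2πi on the outer circle and 0 on the inner one. -/
theorem eq_cauchyTransform_sub {f : ℂ → ℂ} {p s : ℂ} {r R : ℝ} (hr : 0 < r)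
    (hf : ∀ z ∈ closedBall p R \ ball p r, DifferentiableAt ℂ f z)
    (h1 : r < ‖s - p‖) (h2 : ‖s - p‖ < R) :
    f s = cauchyTransform f p R s - cauchyTransform f p r s := by
  have hsR : s ∈ ball p R := by rwa [mem_ball, dist_eq_norm]
  have hR : 0 < R := by linarith
  have hsm : s ∈ closedBall p R \ ball p r :=
    ⟨ball_subset_closedBall hsR, by rw [mem_ball, dist_eq_norm]; linarith⟩
  have hnhds : closedBall p R \ ball p r ∈ 𝓝 s := by
    filter_upwards [isOpen_ball.mem_nhds hsR,
      (isClosed_closedBall (x := p) (ε := r)).isOpen_compl.mem_nhds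
        (by simpa [dist_eq_norm] using h1 : s ∈ (closedBall p r)ᶜ)] with z hz hz'
    exact ⟨ball_subset_closedBall hz, fun h => hz' (ball_subset_closedBall h)⟩
  have hcts : ContinuousOn f (closedBall p R \ ball p r) := fun z hz =>
    (hf z hz).continuousAt.continuousWithinAt
  have hswap := Complex.circleIntegral_eq_of_differentiable_on_annulus_off_countable hr
    (h1.le.trans h2.le) (f := dslope f s) (Set.countable_singleton s)
    ((continuousOn_dslope hnhds).2 ⟨hcts, hf s hsm⟩)
    (fun z hz => (differentiableAt_dslope_of_ne hz.2).2
      (hf z ⟨ball_subset_closedBall hz.1.1, fun h => hz.1.2 (ball_subset_closedBall h)⟩))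
  have expand : ∀ ρ : ℝ, 0 < ρ → ‖s - p‖ ≠ ρ → ContinuousOn f (sphere p ρ) →
      (∮ z in C(p, ρ), dslope f s z) =
        (∮ z in C(p, ρ), f z / (z - s)) - f s * ∮ z in C(p, ρ), (z - s)⁻¹ := by
    intro ρ hρ hne hc
    have hnz : ∀ z ∈ sphere p ρ, z - s ≠ 0 := fun z hz h => hne <| by
      rw [sub_eq_zero.1 h] at hz
      rwa [mem_sphere, dist_eq_norm] at hz
    have hi : ContinuousOn (fun z : ℂ => (z - s)⁻¹) (sphere p ρ) :=
      (by fun_prop : ContinuousOn (fun z : ℂ => z - s) (sphere p ρ)).inv₀ hnz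
    rw [← circleIntegral.integral_const_mul, ← circleIntegral.integral_sub]
    · refine circleIntegral.integral_congr hρ.le fun z hz => ?_
      rw [dslope_of_ne _ (sub_ne_zero.1 (hnz z hz)), slope_def_field]
      ring
    · exact (hc.div (by fun_prop) hnz).circleIntegrable hρ.le
    · exact (continuousOn_const.mul hi).circleIntegrable hρ.le
  have hsubR : sphere p R ⊆ closedBall p R \ ball p r := fun z hz => by
    rw [mem_sphere] at hz
    exact ⟨hz.le, by rw [mem_ball, hz]; linarith⟩
  have hsubr : sphere p r ⊆ closedBall p R \ ball p r := fun z hz => by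
    rw [mem_sphere] at hz
    exact ⟨by rw [mem_closedBall, hz]; linarith, by rw [mem_ball, hz]; linarith⟩
  have hzero : (∮ z in C(p, r), (z - s)⁻¹) = 0 := by
    have hne : ∀ z ∈ closedBall p r, z - s ≠ 0 := fun z hz h => by
      rw [sub_eq_zero.1 h, mem_closedBall, dist_eq_norm] at hz
      linarith
    exact Complex.circleIntegral_eq_zero_of_differentiable_on_off_countable hr.le
      Set.countable_empty (ContinuousOn.inv₀ (by fun_prop) hne)
      fun z hz => DifferentiableAt.inv (by fun_prop) (hne z (ball_subset_closedBall hz.1))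
  rw [expand R hR h2.ne (hcts.mono hsubR), expand r hr h1.ne' (hcts.mono hsubr), hzero,
    circleIntegral.integral_sub_inv_of_mem_ball hsR, mul_zero, sub_zero] at hswap
  rw [cauchyTransform, cauchyTransform, ← hswap]
  field_simp
  simp

/-- A function with finitely many isolated singularities that vanishes at infinity is the sum of
its principal parts. -/
theorem eq_neg_sum_cauchyTransform {f : ℂ → ℂ} {S : Finset ℂ} {r R : ℝ} (hr : 0 < r) (hrR : r < R)
    (hS : ∀ p ∈ S, ∀ q ∈ S, p ≠ q → 2 * R < dist p q)
    (hf : ∀ z ∉ S, DifferentiableAt ℂ f z) (hf0 : Tendsto f (cocompact ℂ) (𝓝 0))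
    {s : ℂ} (hs : ∀ p ∈ S, r < ‖s - p‖) :
    f s = -∑ p ∈ S, cauchyTransform f p r s := by
  classical
  have hsing : ∀ p ∈ S, ∀ z ∈ closedBall p R, z ≠ p → z ∉ S := fun p hp z hz hzp hzS => by
    have := hS z hzS p hp hzp
    rw [mem_closedBall] at hz
    linarith
  have hann : ∀ p ∈ S, ∀ z ∈ closedBall p R \ ball p r, DifferentiableAt ℂ f z :=
    fun p hp z hz => hf z <| hsing p hp z hz.1 fun h => hz.2 (h ▸ mem_ball_self hr)
  have hcont : ∀ p ∈ S, ∀ ρ, r ≤ ρ → ρ ≤ R → ContinuousOn f (sphere p ρ) :=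
    fun p hp ρ h1 h2 z hz => (hann p hp z
      ⟨by rw [mem_closedBall, mem_sphere.1 hz]; exact h2,
        by rw [mem_ball, mem_sphere.1 hz]; linarith⟩).continuousAt.continuousWithinAt
  -- The entire function is f plus all inner Cauchy transforms. Near p the annulus formula trades f
  -- plus the transform over the circle of radius r for the transform over the circle of radius R,
  -- which is holomorphic in the whole disc, p included.
  set H : ℂ → ℂ → ℂ := fun p z =>
    cauchyTransform f p R z + ∑ q ∈ S.erase p, cauchyTransform f q r z with hH
  set G : ℂ → ℂ := fun z => if h : ∃ p ∈ S, dist z p < R then H h.choose z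
    else f z + ∑ q ∈ S, cauchyTransform f q r z with hG
  have hGH : ∀ p ∈ S, ∀ z, dist z p < R → G z = H p z := fun p hp z hz => by
    have hex : ∃ p ∈ S, dist z p < R := ⟨p, hp, hz⟩
    -- The discs of radius R are disjoint because the centres are more than 2R apart, so the chosen
    -- centre is the only one.
    have heq : hex.choose = p := by
      by_contra hne
      have h1 := hS _ hex.choose_spec.1 p hp hne
      have h2 := dist_triangle_left hex.choose p z
      linarith [hex.choose_spec.2]
    simp only [hG, dif_pos hex, heq]
  have hGout : ∀ z, (∀ p ∈ S, r < ‖z - p‖) → G z = f z + ∑ q ∈ S, cauchyTransform f q r z := by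
    intro z hz
    by_cases hex : ∃ p ∈ S, dist z p < R
    · obtain ⟨p, hp, hzp⟩ := hex
      rw [hGH p hp z hzp, hH, eq_cauchyTransform_sub hr (hann p hp) (hz p hp)
        (by rwa [← dist_eq_norm]), ← Finset.add_sum_erase S _ hp]
      ring
    · simp only [hG, dif_neg hex]
  have hdiff : Differentiable ℂ G := by
    intro z
    by_cases hex : ∃ p ∈ S, dist z p < R
    · obtain ⟨p, hp, hzp⟩ := hex
      have hev : G =ᶠ[𝓝 z] H p := by
        filter_upwards [isOpen_ball.mem_nhds (mem_ball.2 hzp)] with w hw using hGH p hp w hw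
      refine hev.differentiableAt_iff.2 (DifferentiableAt.add ?_ ?_)
      · exact differentiableAt_cauchyTransform (hr.trans hrR) (hcont p hp R hrR.le le_rfl)
          (by rw [mem_sphere]; exact hzp.ne)
      · refine DifferentiableAt.fun_sum fun q hq => ?_
        have hqS := Finset.mem_of_mem_erase hq
        refine differentiableAt_cauchyTransform hr (hcont q hqS r le_rfl hrR.le) fun h => ?_
        have h1 := hS q hqS p hp (Finset.ne_of_mem_erase hq)
        have h2 := dist_triangle_left q p z
        rw [mem_sphere] at h
        linarith
    · push Not at hex
      have hev : G =ᶠ[𝓝 z] fun w => f w + ∑ q ∈ S, cauchyTransform f q r w := by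
        have : ∀ᶠ w in 𝓝 z, ∀ p ∈ S, r < ‖w - p‖ := by
          refine (Filter.eventually_all_finset S).2 fun p hp => ?_
          have hc : ContinuousAt (fun w : ℂ => ‖w - p‖) z := by fun_prop
          exact hc.eventually_const_lt (by have := hex p hp; rw [dist_eq_norm] at this; linarith)
        filter_upwards [this] with w hw using hGout w hw
      refine hev.differentiableAt_iff.2 (DifferentiableAt.add ?_ ?_)
      · exact hf z fun h => by have := hex z h; rw [dist_self] at this; linarith
      · refine DifferentiableAt.fun_sum fun q hq => ?_
        refine differentiableAt_cauchyTransform hr (hcont q hq r le_rfl hrR.le) fun h => ?_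
        have := hex q hq
        rw [mem_sphere] at h
        linarith
  have hlim : Tendsto G (cocompact ℂ) (𝓝 0) := by
    have h1 : Tendsto (fun z => f z + ∑ q ∈ S, cauchyTransform f q r z) (cocompact ℂ) (𝓝 0) := by
      simpa using hf0.add (tendsto_finsetSum S fun q hq =>
        tendsto_cauchyTransform_cocompact hr.le (hcont q hq r le_rfl hrR.le))
    refine h1.congr' ?_
    have : ∀ᶠ w in cocompact ℂ, ∀ p ∈ S, r < ‖w - p‖ := by
      refine (Filter.eventually_all_finset S).2 fun p _ => ?_
      have hinf : Tendsto (fun s : ℂ => ‖s - p‖) (cocompact ℂ) atTop := by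
        simpa only [dist_eq_norm] using tendsto_dist_right_cocompact_atTop p
      exact hinf.eventually_gt_atTop r
    filter_upwards [this] with w hw using (hGout w hw).symm
  -- Liouville's theorem.
  have h0 : G s = 0 := hdiff.apply_eq_of_tendsto_cocompact s hlim
  rw [hGout s hs] at h0
  exact eq_neg_of_add_eq_zero_left h0

end CauchyTransform

/-! ### Laplace transforms and series expansions of circle integrals. -/

section CircleKernels

open Filter Topology Metric

theorem circleIntegral_translate (f : ℂ → ℂ) (p : ℂ) (r : ℝ) :
    (∮ z in C(p, r), f z) = ∮ w in C(0, r), f (p + w) := by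
  simp [circleIntegral, circleMap]

/-- The normalised integral of `e^{xz} f z` along a circle, as a function of `x`. -/
noncomputable def circleExp (f : ℂ → ℂ) (p : ℂ) (r : ℝ) (x : ℝ) : ℂ :=
  (2 * Real.pi * Complex.I)⁻¹ * ∮ z in C(p, r), f z * Complex.exp (z * x)

/-- Supplies the hypothesis of Fubini: on a circle in Re z ≤ -δ the kernel is dominated by a
constant times e^{-δx}, as |e^{ax}| ≤ 1 for x > 0. -/
theorem integrable_circleExp_kernel {f : ℂ → ℂ} {p : ℂ} {r δ : ℝ} (hr : 0 < r) (hδ : 0 < δ)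
    (hf : ContinuousOn f (sphere p r)) (hre : ∀ z ∈ sphere p r, z.re ≤ -δ)
    {a : ℂ} (ha : a.re ≤ 0) {τ : ℝ} (hτ : 0 ≤ τ) :
    Integrable (Function.uncurry fun (x θ : ℝ) => Complex.exp (a * x) *
        (deriv (circleMap p r) θ • (f (circleMap p r θ) * Complex.exp (circleMap p r θ * x))))
      ((volume.restrict (Set.Ioi τ)).prod (volume.restrict (Set.Ioc 0 (2 * Real.pi)))) := by
  have hmem : ∀ θ : ℝ, circleMap p r θ ∈ sphere p r := fun θ => circleMap_mem_sphere p hr.le θ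
  have hcf : Continuous fun θ : ℝ => f (circleMap p r θ) :=
    hf.comp_continuous (continuous_circleMap p r) hmem
  obtain ⟨C, hC⟩ := (isCompact_sphere p r).exists_bound_of_continuousOn hf
  have hC0 : 0 ≤ C := (norm_nonneg _).trans (hC _ (hmem 0))
  have hb : Integrable (fun q : ℝ × ℝ => Real.exp (-δ * q.1) * (r * C))
      ((volume.restrict (Set.Ioi τ)).prod (volume.restrict (Set.Ioc 0 (2 * Real.pi)))) :=
    Integrable.mul_prod (f := fun x : ℝ => Real.exp (-δ * x)) (g := fun _ : ℝ => r * C)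
      (exp_neg_integrableOn_Ioi τ hδ) (integrable_const _)
  have hcont : Continuous (Function.uncurry fun (x θ : ℝ) => Complex.exp (a * x) *
      (deriv (circleMap p r) θ • (f (circleMap p r θ) * Complex.exp (circleMap p r θ * x)))) := by
    simp only [deriv_circleMap, Function.uncurry_def, smul_eq_mul]
    have h1 : Continuous fun q : ℝ × ℝ => f (circleMap p r q.2) := hcf.comp continuous_snd
    have h2 : ∀ c, Continuous fun q : ℝ × ℝ => circleMap c r q.2 :=
      fun c => (continuous_circleMap c r).comp continuous_snd
    have h3 := h2 p
    have h4 : Continuous fun q : ℝ × ℝ => (q.1 : ℂ) := Complex.continuous_ofReal.comp continuous_fst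
    exact (Complex.continuous_exp.comp (continuous_const.mul h4)).mul
      (((h2 0).mul continuous_const).mul
        (h1.mul (Complex.continuous_exp.comp (h3.mul h4))))
  refine hb.mono' hcont.aestronglyMeasurable ?_
  have hpos : ∀ᵐ q : ℝ × ℝ ∂((volume.restrict (Set.Ioi τ)).prod
      (volume.restrict (Set.Ioc 0 (2 * Real.pi)))), q.1 ∈ Set.Ioi τ :=
    Measure.quasiMeasurePreserving_fst.ae (ae_restrict_mem measurableSet_Ioi)
  filter_upwards [hpos] with q hq
  have hx : 0 < q.1 := hτ.trans_lt hq
  have h1 := hre _ (hmem q.2)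
  have h2 := hC _ (hmem q.2)
  simp only [Function.uncurry, norm_mul, norm_smul, Complex.norm_exp, deriv_circleMap,
    Complex.norm_I, norm_circleMap_zero, abs_of_pos hr, mul_one, Complex.re_mul_ofReal]
  calc Real.exp (a.re * q.1) * (r * (‖f (circleMap p r q.2)‖ * Real.exp
        ((circleMap p r q.2).re * q.1)))
      ≤ 1 * (r * (C * Real.exp (-δ * q.1))) := by
        gcongr
        exact Real.exp_le_one_iff.2 (mul_nonpos_of_nonpos_of_nonneg ha hx.le)
    _ = _ := by ring

theorem exp_mul_circleExp (f : ℂ → ℂ) (p : ℂ) (r : ℝ) (a : ℂ) (x : ℝ) :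
    Complex.exp (a * x) * circleExp f p r x = (2 * Real.pi * Complex.I)⁻¹ *
      ∫ θ in Set.Ioc 0 (2 * Real.pi), Complex.exp (a * x) *
        (deriv (circleMap p r) θ • (f (circleMap p r θ) * Complex.exp (circleMap p r θ * x))) := by
  rw [circleExp, circleIntegral, intervalIntegral.integral_of_le (by positivity),
    MeasureTheory.integral_const_mul]
  ring

theorem integrableOn_circleExp {f : ℂ → ℂ} {p : ℂ} {r δ : ℝ} (hr : 0 < r) (hδ : 0 < δ)
    (hf : ContinuousOn f (sphere p r)) (hre : ∀ z ∈ sphere p r, z.re ≤ -δ)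
    {a : ℂ} (ha : a.re ≤ 0) {τ : ℝ} (hτ : 0 ≤ τ) :
    IntegrableOn (fun x : ℝ => Complex.exp (a * x) * circleExp f p r x) (Set.Ioi τ) := by
  simp only [exp_mul_circleExp]
  exact ((integrable_circleExp_kernel hr hδ hf hre ha hτ).integral_prod_left).const_mul _

/-- Fubini, then the integral of e^{(z+a)x} over x > τ equals -e^{(z+a)τ}/(z+a) because Re(z+a) < 0.
The case τ = 0, a = it yields the characteristic function; the case a = 0 yields the tail. -/
theorem integral_Ioi_exp_mul_circleExp {f : ℂ → ℂ} {p : ℂ} {r δ : ℝ} (hr : 0 < r) (hδ : 0 < δ)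
    (hf : ContinuousOn f (sphere p r)) (hre : ∀ z ∈ sphere p r, z.re ≤ -δ)
    {a : ℂ} (ha : a.re ≤ 0) {τ : ℝ} (hτ : 0 ≤ τ) :
    ∫ x in Set.Ioi τ, Complex.exp (a * x) * circleExp f p r x =
      -((2 * Real.pi * Complex.I)⁻¹ *
        ∮ z in C(p, r), f z * Complex.exp ((z + a) * τ) / (z + a)) := by
  have hmem : ∀ θ : ℝ, circleMap p r θ ∈ sphere p r := fun θ => circleMap_mem_sphere p hr.le θ
  simp only [exp_mul_circleExp]
  rw [MeasureTheory.integral_const_mul,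
    integral_integral_swap (integrable_circleExp_kernel hr hδ hf hre ha hτ), ← mul_neg,
    circleIntegral, intervalIntegral.integral_of_le (by positivity), ← integral_neg]
  congr 1
  refine integral_congr_ae (Eventually.of_forall fun θ => ?_)
  have h1 : (circleMap p r θ + a).re < 0 := by
    have := hre _ (hmem θ)
    rw [Complex.add_re]
    linarith
  have h2 : ∀ x : ℝ, Complex.exp (a * x) * (deriv (circleMap p r) θ • (f (circleMap p r θ) *
      Complex.exp (circleMap p r θ * x))) = (deriv (circleMap p r) θ * f (circleMap p r θ)) *
        Complex.exp ((circleMap p r θ + a) * x) := fun x => by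
    rw [add_mul, Complex.exp_add, smul_eq_mul]
    ring
  simp only [h2]
  rw [MeasureTheory.integral_const_mul, integral_exp_mul_complex_Ioi h1, smul_eq_mul]
  ring

/-- Expand exp(b/w) in powers of 1/w. On the circle the n-th term is dominated by a multiple of
(|b|/r)^n/n!, so the sum and the integral may be exchanged, and each resulting integral of
g(w)/w^(κ+n) is a derivative of g at 0. -/
theorem hasSum_circleIntegral_mul_exp_div {g : ℂ → ℂ} {r : ℝ} (hr : 0 < r)
    (hg : DifferentiableOn ℂ g (closedBall 0 r)) (b : ℂ) {κ : ℕ} (hκ : 1 ≤ κ) :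
    HasSum (fun n : ℕ => 1 / ((κ - 1 + n).factorial : ℂ) * iteratedDeriv (κ - 1 + n) g 0 *
        (1 / (n.factorial : ℂ)) * b ^ n)
      ((2 * Real.pi * Complex.I)⁻¹ *
        ∮ w in C(0, r), g w * Complex.exp (b / w) / w ^ κ) := by
  have hgc : ContinuousOn g (sphere 0 r) := hg.continuousOn.mono sphere_subset_closedBall
  have hmem : ∀ θ : ℝ, circleMap 0 r θ ∈ sphere (0 : ℂ) r :=
    fun θ => circleMap_mem_sphere 0 hr.le θ
  have hne : ∀ θ : ℝ, circleMap 0 r θ ≠ 0 := fun θ => circleMap_ne_center hr.ne'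
  have hcg : Continuous fun θ : ℝ => g (circleMap 0 r θ) :=
    hgc.comp_continuous (continuous_circleMap 0 r) hmem
  obtain ⟨C, hC⟩ := (isCompact_sphere (0 : ℂ) r).exists_bound_of_continuousOn hgc
  have hC0 : 0 ≤ C := (norm_nonneg _).trans (hC _ (hmem 0))
  have key := intervalIntegral.hasSum_integral_of_dominated_convergence
    (μ := volume) (a := 0) (b := 2 * Real.pi)
    (F := fun (n : ℕ) θ => deriv (circleMap 0 r) θ • (g (circleMap 0 r θ) *
      ((b / circleMap 0 r θ) ^ n / n.factorial) / circleMap 0 r θ ^ κ))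
    (f := fun θ => deriv (circleMap 0 r) θ • (g (circleMap 0 r θ) *
      Complex.exp (b / circleMap 0 r θ) / circleMap 0 r θ ^ κ))
    (fun n _ => r * (C * ((‖b‖ / r) ^ n / n.factorial) / r ^ κ))
    (fun n => by
      refine Continuous.aestronglyMeasurable ?_
      simp only [deriv_circleMap]
      refine (by fun_prop : Continuous fun θ : ℝ => circleMap 0 r θ * Complex.I).smul
        ((hcg.mul ?_).div (by fun_prop) fun θ => pow_ne_zero _ (hne θ))
      exact ((continuous_const.div (by fun_prop) hne).pow n).div_const _)
    (fun n => by
      refine Eventually.of_forall fun θ _ => ?_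
      have := hC _ (hmem θ)
      simp only [norm_smul, norm_div, norm_mul, norm_pow, deriv_circleMap, Complex.norm_I,
        norm_circleMap_zero, abs_of_pos hr, mul_one, Complex.norm_natCast]
      gcongr)
    (Eventually.of_forall fun θ _ =>
      (((Real.summable_pow_div_factorial (‖b‖ / r)).mul_left C).div_const _).mul_left r)
    (by simp)
    (Eventually.of_forall fun θ _ => by
      have h1 := NormedSpace.expSeries_div_hasSum_exp (𝔸 := ℂ) (b / circleMap 0 r θ)
      rw [← Complex.exp_eq_exp_ℂ] at h1
      exact ((h1.mul_left (g (circleMap 0 r θ))).div_const _).const_smul _)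
  have key2 := key.mul_left (2 * Real.pi * Complex.I)⁻¹
  refine key2.congr_fun ?_
  intro n
  have h1 := hg.circleIntegral_one_div_sub_center_pow_smul hr (κ - 1 + n)
  -- The subtraction is truncated, so this needs κ ≥ 1.
  have h2 : κ - 1 + n + 1 = κ + n := by omega
  have h3 : (∫ θ in (0)..(2 * Real.pi), deriv (circleMap 0 r) θ • (g (circleMap 0 r θ) *
      ((b / circleMap 0 r θ) ^ n / n.factorial) / circleMap 0 r θ ^ κ)) =
      (b ^ n / n.factorial) * ∮ z in C(0, r), (1 / (z - 0) ^ (κ - 1 + n + 1)) • g z := by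
    rw [← circleIntegral.integral_const_mul, circleIntegral]
    congr 1
    ext θ
    congr 1
    rw [h2, sub_zero, div_pow, pow_add, smul_eq_mul]
    have := hne θ
    field_simp
  rw [h3, h1, smul_eq_mul]
  have hpi : (Real.pi : ℂ) ≠ 0 := by exact_mod_cast Real.pi_ne_zero
  field_simp

end CircleKernels

/-! ### Recovering a density from a characteristic function. -/

section FourierDensity

theorem integrable_exp_mul_I_mul {f : ℝ → ℂ} (hf : Integrable f) (t : ℝ) :
    Integrable fun x : ℝ => Complex.exp (t * x * Complex.I) * f x :=
  hf.bdd_mul (c := 1) (by fun_prop) (Filter.Eventually.of_forall fun x => by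
    rw [← Complex.ofReal_mul, Complex.norm_exp_ofReal_mul_I])

theorem integral_withDensity_ofReal {h : ℝ → ℝ} (hh : Integrable h) (ψ : ℝ → ℂ) :
    ∫ x, ψ x ∂(volume.withDensity fun x => ENNReal.ofReal (h x)) =
      ∫ x, ψ x * (max (h x) 0 : ℝ) := by
  rw [integral_withDensity_eq_integral_toReal_smul₀ hh.aemeasurable.ennreal_ofReal
    (Filter.Eventually.of_forall fun x => ENNReal.ofReal_lt_top)]
  refine integral_congr_ae (Filter.Eventually.of_forall fun x => ?_)
  simp only [ENNReal.toReal_ofReal', Complex.real_smul]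
  ring

/-- A finite measure whose characteristic function is the Fourier transform of a real integrable
function has that function as density. -/
theorem measureReal_eq_setIntegral_of_charFun {ν : Measure ℝ} [IsFiniteMeasure ν] {h : ℝ → ℝ}
    (hh : Integrable h)
    (hν : ∀ t : ℝ, charFun ν t = ∫ x : ℝ, Complex.exp (t * x * Complex.I) * h x)
    {A : Set ℝ} (hA : MeasurableSet A) : ν.real A = ∫ x in A, h x := by
  have hfin : ∀ u : ℝ → ℝ, Integrable u →
      IsFiniteMeasure (volume.withDensity fun x => ENNReal.ofReal (u x)) := fun u hu =>
    isFiniteMeasure_withDensity_ofReal hu.hasFiniteIntegral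
  have := hfin h hh
  have := hfin (fun x => -h x) hh.neg
  have hmax : ∀ u : ℝ → ℝ, Integrable u → ∀ t : ℝ, Integrable fun x : ℝ =>
      Complex.exp (t * x * Complex.I) * (max (u x) 0 : ℝ) := fun u hu t =>
    integrable_exp_mul_I_mul hu.pos_part.ofReal t
  have hhc : Integrable fun x => (h x : ℂ) := hh.ofReal
  -- The sign of h is not known in advance. Moving its negative part to the side of ν leaves two
  -- finite positive measures, to which uniqueness of characteristic functions applies.
  have hadd : ν + volume.withDensity (fun x => ENNReal.ofReal (-h x)) =
      volume.withDensity fun x => ENNReal.ofReal (h x) := by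
    refine Measure.ext_of_charFun (funext fun t => ?_)
    have hI : ∀ (μ : Measure ℝ) [IsFiniteMeasure μ],
        Integrable (fun x : ℝ => Complex.exp (t * x * Complex.I)) μ := fun μ _ =>
      (integrable_const (1 : ℝ)).mono' (by fun_prop) (Filter.Eventually.of_forall fun x => by
        rw [← Complex.ofReal_mul, Complex.norm_exp_ofReal_mul_I])
    rw [charFun_apply_real, integral_add_measure (hI _) (hI _), ← charFun_apply_real, hν,
      charFun_apply_real, integral_withDensity_ofReal hh,
      integral_withDensity_ofReal (h := fun x => -h x) hh.neg,
      ← integral_add (integrable_exp_mul_I_mul hhc t) (hmax (fun x => -h x) hh.neg t)]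
    refine integral_congr_ae (Filter.Eventually.of_forall fun x => ?_)
    simp only
    rw [← mul_add, ← Complex.ofReal_add]
    congr 2
    rcases le_total 0 (h x) with h0 | h0
    · rw [max_eq_right (by linarith), max_eq_left h0, add_zero]
    · rw [max_eq_left (by linarith), max_eq_right h0, add_neg_cancel]
  have hreal : (ν + volume.withDensity (fun x => ENNReal.ofReal (-h x))).real A =
      (volume.withDensity fun x => ENNReal.ofReal (h x)).real A := by rw [hadd]
  rw [measureReal_add_apply] at hreal
  rw [integral_eq_lintegral_pos_part_sub_lintegral_neg_part hh.integrableOn,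
    ← withDensity_apply _ hA, ← withDensity_apply _ hA]
  simp only [Measure.real] at hreal ⊢
  linarith

/-- Conjugating the characteristic function at -t shows that f and its conjugate have the same
Fourier transform. So the real part of f represents ν and its imaginary part represents the zero
measure. This spares a direct proof that the contour-integral density is real. -/
theorem ofReal_measureReal_eq_setIntegral_of_charFun {ν : Measure ℝ} [IsFiniteMeasure ν]
    {f : ℝ → ℂ} (hf : Integrable f)
    (hν : ∀ t : ℝ, charFun ν t = ∫ x : ℝ, Complex.exp (t * x * Complex.I) * f x)
    {A : Set ℝ} (hA : MeasurableSet A) : (ν.real A : ℂ) = ∫ x in A, f x := by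
  have hconj : ∀ t : ℝ, charFun ν t =
      ∫ x : ℝ, Complex.exp (t * x * Complex.I) * (starRingEnd ℂ) (f x) := fun t => by
    have h1 := charFun_neg (μ := ν) (-t)
    rw [neg_neg, hν (-t), ← integral_conj] at h1
    rw [h1]
    refine integral_congr_ae (Filter.Eventually.of_forall fun x => ?_)
    simp [← Complex.exp_conj]
  have hfc : Integrable fun x => (starRingEnd ℂ) (f x) :=
    (Complex.conjLIE.toContinuousLinearEquiv.toContinuousLinearMap.integrable_comp hf :)
  have hre : ∀ t : ℝ, charFun ν t =
      ∫ x : ℝ, Complex.exp (t * x * Complex.I) * ((f x).re : ℂ) := fun t => by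
    have h1 : ∀ x : ℝ, Complex.exp (t * x * Complex.I) * ((f x).re : ℂ) =
        (1 / 2) * (Complex.exp (t * x * Complex.I) * f x +
          Complex.exp (t * x * Complex.I) * (starRingEnd ℂ) (f x)) := fun x => by
      rw [← mul_add, Complex.add_conj]
      push_cast
      ring
    simp only [h1]
    rw [integral_const_mul, integral_add (integrable_exp_mul_I_mul hf t)
      (integrable_exp_mul_I_mul hfc t), ← hν, ← hconj]
    ring
  have him : ∀ t : ℝ, charFun (0 : Measure ℝ) t =
      ∫ x : ℝ, Complex.exp (t * x * Complex.I) * ((f x).im : ℂ) := fun t => by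
    have h1 : ∀ x : ℝ, Complex.exp (t * x * Complex.I) * ((f x).im : ℂ) =
        (1 / (2 * Complex.I)) * (Complex.exp (t * x * Complex.I) * f x -
          Complex.exp (t * x * Complex.I) * (starRingEnd ℂ) (f x)) := fun x => by
      rw [← mul_sub, Complex.sub_conj]
      push_cast
      field_simp
    simp only [h1]
    rw [integral_const_mul, integral_sub (integrable_exp_mul_I_mul hf t)
      (integrable_exp_mul_I_mul hfc t), ← hν, ← hconj]
    simp
  have h1 := measureReal_eq_setIntegral_of_charFun hf.re hre hA
  have h2 := measureReal_eq_setIntegral_of_charFun hf.im him hA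
  simp only [Measure.real, Measure.coe_zero, Pi.zero_apply, ENNReal.toReal_zero] at h2
  rw [← integral_re_add_im hf.integrableOn]
  simp only [Measure.real] at h1 h2 ⊢
  rw [h1]
  simp only [RCLike.re_to_complex, RCLike.im_to_complex] at h1 h2 ⊢
  rw [← h2]
  simp

end FourierDensity

/-! ### The transform of the quadratic form, its singularities, and the tail series. -/

namespace OutageSeries

open Filter Topology Metric

variable {ι : Type*} [Fintype ι]

/-- The Laplace transform of `∑ a, Λ a * ‖z a + χ a‖ ^ 2` for independent standard circular
Gaussian `z a`, with equal eigenvalues grouped. -/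
noncomputable def laplace (Λ : ι → ℝ) (χ : ι → ℂ) (s : ℂ) : ℂ :=
  Complex.exp (-∑ p ∈ distinct Λ, s * p / (1 + s * p) * energy Λ χ p) /
    ∏ p ∈ distinct Λ, (1 + s * p) ^ mult Λ p

theorem mult_pos {Λ : ι → ℝ} {l : ℝ} (hl : l ∈ distinct Λ) : 1 ≤ mult Λ l := by
  obtain ⟨a, -, ha⟩ := Finset.mem_image.1 hl
  exact Finset.card_pos.2 ⟨a, Finset.mem_filter.2 ⟨Finset.mem_univ _, ha⟩⟩

theorem pos_of_mem_distinct {Λ : ι → ℝ} (hΛ : ∀ a, 0 < Λ a) {l : ℝ} (hl : l ∈ distinct Λ) :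
    0 < l := by
  obtain ⟨a, -, rfl⟩ := Finset.mem_image.1 hl
  exact hΛ a

/-- Provides one scale ε for all contours: circles of radius a fraction of ε around the points -1/l
stay disjoint and inside the left half-plane. -/
theorem exists_pole_separation {Λ : ι → ℝ} (hΛ : ∀ a, 0 < Λ a) :
    ∃ ε : ℝ, 0 < ε ∧ (∀ l ∈ distinct Λ, ε < 1 / l) ∧
      ∀ l ∈ distinct Λ, ∀ p ∈ distinct Λ, l ≠ p → ε < |1 / l - 1 / p| := by
  have h1 : ∀ᶠ ε in 𝓝[>] (0 : ℝ), ∀ l ∈ distinct Λ, ε < 1 / l :=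
    (eventually_all_finset _).2 fun l hl => nhdsWithin_le_nhds <|
      eventually_lt_nhds (one_div_pos.2 (pos_of_mem_distinct hΛ hl))
  have h2 : ∀ᶠ ε in 𝓝[>] (0 : ℝ), ∀ l ∈ distinct Λ, ∀ p ∈ distinct Λ, l ≠ p →
      ε < |1 / l - 1 / p| :=
    (eventually_all_finset _).2 fun l _ => (eventually_all_finset _).2 fun p _ =>
      eventually_imp_distrib_left.2 fun hlp => nhdsWithin_le_nhds <| eventually_lt_nhds <|
        abs_pos.2 <| sub_ne_zero.2 fun h => hlp (by simpa using h)
  obtain ⟨ε, ⟨h1, h2⟩, h3⟩ := ((h1.and h2).and self_mem_nhdsWithin).exists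
  exact ⟨ε, h3, h1, h2⟩

theorem one_add_mul_ne_zero {l : ℝ} (hl : 0 < l) {s : ℂ} (hs : s ≠ ((-(1 / l) : ℝ) : ℂ)) :
    1 + s * l ≠ 0 := fun h => hs <| by
  have : (l : ℂ) ≠ 0 := by exact_mod_cast hl.ne'
  push_cast
  field_simp
  linear_combination h

theorem differentiableAt_laplace {Λ : ι → ℝ} (χ : ι → ℂ) {s : ℂ}
    (hs : ∀ p ∈ distinct Λ, 1 + s * p ≠ 0) : DifferentiableAt ℂ (laplace Λ χ) s := by
  unfold laplace
  refine DifferentiableAt.div ?_ ?_ ?_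
  · refine DifferentiableAt.cexp (DifferentiableAt.neg (DifferentiableAt.fun_sum fun p hp => ?_))
    refine DifferentiableAt.mul_const (DifferentiableAt.fun_div ?_ ?_ ?_) _
    · fun_prop
    · fun_prop
    · exact hs p hp
  · exact DifferentiableAt.fun_finsetProd fun p hp => by fun_prop
  · exact Finset.prod_ne_zero_iff.2 fun p hp => pow_ne_zero _ (hs p hp)

/-- Since sp/(1+sp) tends to 1, the exponential factor has a finite limit despite its essential
singularities, while at least one factor 1/(1+sp) is present and tends to 0. -/
theorem tendsto_laplace_cocompact [Nonempty ι] {Λ : ι → ℝ} (hΛ : ∀ a, 0 < Λ a) (χ : ι → ℂ) :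
    Tendsto (laplace Λ χ) (cocompact ℂ) (𝓝 0) := by
  have hinv : ∀ p ∈ distinct Λ, Tendsto (fun s : ℂ => (1 + s * p)⁻¹) (cocompact ℂ) (𝓝 0) := by
    intro p hp
    have hp0 : (p : ℂ) ≠ 0 := by exact_mod_cast (pos_of_mem_distinct hΛ hp).ne'
    refine (tendsto_inv₀_cobounded (α := ℂ)).comp ?_
    rw [← cobounded_eq_cocompact]
    exact (tendsto_const_add_cobounded _).comp (tendsto_mul_right_cobounded hp0)
  have hfrac : ∀ p ∈ distinct Λ,
      Tendsto (fun s : ℂ => s * p / (1 + s * p)) (cocompact ℂ) (𝓝 1) := by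
    intro p hp
    have h1 := (hinv p hp).const_sub 1
    rw [sub_zero] at h1
    refine h1.congr' ?_
    have hfin : ∀ᶠ s : ℂ in cocompact ℂ, s ≠ ((-(1 / p) : ℝ) : ℂ) := by
      rw [← cobounded_eq_cocompact]
      exact Bornology.eventually_ne_cobounded _
    filter_upwards [hfin] with s hs
    have := one_add_mul_ne_zero (pos_of_mem_distinct hΛ hp) hs
    field_simp
    ring
  have h1 : Tendsto (fun s : ℂ => Complex.exp (-∑ p ∈ distinct Λ, s * p / (1 + s * p) *
      energy Λ χ p)) (cocompact ℂ) (𝓝 (Complex.exp (-∑ p ∈ distinct Λ, 1 * (energy Λ χ p : ℂ)))) :=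
    (Complex.continuous_exp.tendsto _).comp
      (tendsto_finsetSum _ fun p hp => (hfrac p hp).mul_const _).neg
  have h2 : Tendsto (fun s : ℂ => ∏ p ∈ distinct Λ, (1 + s * p)⁻¹ ^ mult Λ p) (cocompact ℂ)
      (𝓝 (∏ p ∈ distinct Λ, 0 ^ mult Λ p)) :=
    tendsto_finsetProd _ fun p hp => (hinv p hp).pow _
  obtain ⟨a⟩ := ‹Nonempty ι›
  have ha : Λ a ∈ distinct Λ := Finset.mem_image_of_mem _ (Finset.mem_univ a)
  rw [Finset.prod_eq_zero ha (zero_pow (by have := mult_pos ha; omega))] at h2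
  have h3 := h1.mul h2
  rw [mul_zero] at h3
  refine h3.congr fun s => ?_
  simp only [laplace, div_eq_mul_inv, ← Finset.prod_inv_distrib, inv_pow]

theorem differentiableAt_g (τ : ℝ) {Λ : ι → ℝ} (χ : ι → ℂ) {l : ℝ} {w : ℂ}
    (hw : w - 1 / l ≠ 0) (hs : ∀ p ∈ (distinct Λ).erase l, 1 + (w - 1 / l) * p ≠ 0) :
    DifferentiableAt ℂ (g τ Λ χ l) w := by
  unfold g
  refine DifferentiableAt.mul (DifferentiableAt.div (by fun_prop) (by fun_prop) hw)
    (DifferentiableAt.div ?_ ?_ ?_)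
  · refine DifferentiableAt.cexp (DifferentiableAt.neg (DifferentiableAt.fun_sum fun p hp => ?_))
    refine DifferentiableAt.mul_const (DifferentiableAt.fun_div ?_ ?_ ?_) _
    · fun_prop
    · fun_prop
    · exact hs p hp
  · exact DifferentiableAt.fun_finsetProd fun p hp => by fun_prop
  · exact Finset.prod_ne_zero_iff.2 fun p hp => pow_ne_zero _ (hs p hp)

/-- At s = w - 1/l the factor 1+sl becomes wl, and sl/(1+sl) = 1 - 1/(lw). The exponent belonging to
l thus splits into the constant -E and the singular part E/(lw), with E the energy of l. -/
theorem laplace_mul_exp_div_eq (τ : ℝ) {Λ : ι → ℝ} (χ : ι → ℂ) {l : ℝ} (hl : 0 < l)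
    (hmem : l ∈ distinct Λ) {w : ℂ} (hw : w ≠ 0) :
    laplace Λ χ (w - 1 / l) * Complex.exp ((w - 1 / l) * τ) / (w - 1 / l) =
      Complex.exp (-(τ / l + energy Λ χ l)) / (l : ℂ) ^ mult Λ l *
        (g τ Λ χ l w * Complex.exp (((energy Λ χ l / l : ℝ) : ℂ) / w) / w ^ mult Λ l) := by
  have hl0 : (l : ℂ) ≠ 0 := by exact_mod_cast hl.ne'
  have h1 : 1 + (w - 1 / l) * l = w * l := by field_simp; ring
  unfold laplace g
  rw [← Finset.add_sum_erase _ _ hmem, ← Finset.mul_prod_erase _ _ hmem, h1, neg_add,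
    Complex.exp_add, mul_pow]
  have h2 : Complex.exp (-((w - 1 / l) * l / (w * l) * energy Λ χ l)) *
      Complex.exp ((w - 1 / l) * τ) = Complex.exp (-(τ / l + energy Λ χ l)) *
        Complex.exp (τ * w) * Complex.exp (((energy Λ χ l / l : ℝ) : ℂ) / w) := by
    rw [← Complex.exp_add, ← Complex.exp_add, ← Complex.exp_add]
    congr 1
    push_cast
    field_simp
    ring
  calc _ = (Complex.exp (-((w - 1 / l) * l / (w * l) * energy Λ χ l)) *
      Complex.exp ((w - 1 / l) * τ)) * (Complex.exp (-∑ p ∈ (distinct Λ).erase l,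
        (w - 1 / l) * p / (1 + (w - 1 / l) * p) * energy Λ χ p) /
      (w ^ mult Λ l * l ^ mult Λ l *
        ∏ p ∈ (distinct Λ).erase l, (1 + (w - 1 / l) * p) ^ mult Λ p)) / (w - 1 / l) := by ring
    _ = _ := by
      rw [h2]
      simp only [div_eq_mul_inv, mul_inv]
      ring

/-- A measure on the line whose characteristic function is `laplace Λ χ (-it)` has its tail given
by the series. -/
theorem measureReal_Ici_eq [Nonempty ι] {Λ : ι → ℝ} (hΛ : ∀ a, 0 < Λ a) (χ : ι → ℂ)
    {ν : Measure ℝ} [IsFiniteMeasure ν]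
    (hν : ∀ t : ℝ, charFun ν t = laplace Λ χ (-(t * Complex.I))) {τ : ℝ} (hτ : 0 ≤ τ) :
    (∀ l ∈ distinct Λ, Summable (term τ Λ χ l)) ∧
    (ν.real (Set.Ici τ) : ℂ) = -∑ l ∈ distinct Λ,
      Complex.exp (-(τ / l + energy Λ χ l)) / (l : ℂ) ^ mult Λ l * ∑' r : ℕ, term τ Λ χ l r := by
  classical
  obtain ⟨ε, hε, hε1, hε2⟩ := exists_pole_separation hΛ
  -- The outer radius below is ε/3: then r < ε/3, and twice ε/3 is still less than the separation ε.
  -- The circles of radius r lie in Re z ≤ -r because 1/l > ε.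
  set r : ℝ := ε / 4 with hrdef
  have hr : 0 < r := by positivity
  have hpos : ∀ l ∈ distinct Λ, 0 < l := fun l hl => pos_of_mem_distinct hΛ hl
  set pole : ℝ → ℂ := fun l => ((-(1 / l) : ℝ) : ℂ) with hpole
  have hdist : ∀ l p : ℝ, dist (pole l) (pole p) = |1 / l - 1 / p| := fun l p => by
    rw [hpole, Complex.dist_eq, ← Complex.ofReal_sub, Complex.norm_real, Real.norm_eq_abs,
      ← abs_neg]
    congr 1
    ring
  have hinj : Set.InjOn pole (distinct Λ) := fun l _ p _ h => by
    simpa [hpole] using h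
  have hsphere : ∀ l ∈ distinct Λ, ∀ z ∈ sphere (pole l) r, ∀ p ∈ distinct Λ, 1 + z * p ≠ 0 := by
    intro l hl z hz p hp
    refine one_add_mul_ne_zero (hpos p hp) fun h => ?_
    change z = pole p at h
    rw [mem_sphere, h] at hz
    rcases eq_or_ne p l with rfl | hpl
    · rw [dist_self] at hz
      exact hr.ne hz
    · have := hε2 p hp l hl hpl
      rw [hdist] at hz
      linarith
  have hre : ∀ l ∈ distinct Λ, ∀ z ∈ sphere (pole l) r, z.re ≤ -r := by
    intro l hl z hz
    have h1 : (z - pole l).re ≤ r := by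
      rw [mem_sphere, dist_eq_norm] at hz
      exact hz ▸ Complex.re_le_norm _
    have h2 := hε1 l hl
    simp only [hpole, Complex.sub_re, Complex.ofReal_re] at h1
    linarith
  have hcont : ∀ l ∈ distinct Λ, ContinuousOn (laplace Λ χ) (sphere (pole l) r) :=
    fun l hl z hz => (differentiableAt_laplace χ
      (hsphere l hl z hz)).continuousAt.continuousWithinAt
  have hpf : ∀ t : ℝ, laplace Λ χ (-(t * Complex.I)) =
      -∑ l ∈ distinct Λ, cauchyTransform (laplace Λ χ) (pole l) r (-(t * Complex.I)) := by
    intro t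
    rw [eq_neg_sum_cauchyTransform (S := (distinct Λ).image pole) (R := ε / 3) hr (by linarith)
      ?_ ?_ (tendsto_laplace_cocompact hΛ χ) ?_, Finset.sum_image hinj]
    · simp only [Finset.forall_mem_image]
      intro l hl p hp hlp
      rw [hdist]
      have := hε2 l hl p hp fun h => hlp (by rw [h])
      linarith
    · intro z hz
      refine differentiableAt_laplace χ fun p hp => one_add_mul_ne_zero (hpos p hp) fun h => hz ?_
      exact Finset.mem_image.2 ⟨p, hp, h.symm⟩
    · simp only [Finset.forall_mem_image]
      intro l hl
      have h1 := Complex.re_le_norm (-(t * Complex.I) - pole l)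
      have h2 := hε1 l hl
      simp only [hpole, Complex.sub_re, Complex.ofReal_re, Complex.neg_re, Complex.mul_re,
        Complex.I_re, Complex.ofReal_im] at h1
      linarith
  -- The candidate density of the measure on x > 0, by inverse Laplace transform.
  set φ : ℝ → ℂ := fun x => ∑ l ∈ distinct Λ, circleExp (laplace Λ χ) (pole l) r x with hφ
  have hφint : IntegrableOn φ (Set.Ioi 0) := by
    refine integrable_finsetSum _ fun l hl => ?_
    simpa [IntegrableOn] using
      integrableOn_circleExp hr hr (hcont l hl) (hre l hl) (a := 0) le_rfl le_rfl
  have hφlap : ∀ a : ℂ, a.re ≤ 0 → ∀ T : ℝ, 0 ≤ T →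
      ∫ x in Set.Ioi T, Complex.exp (a * x) * φ x = -∑ l ∈ distinct Λ,
        ((2 * Real.pi * Complex.I)⁻¹ * ∮ z in C(pole l, r),
          laplace Λ χ z * Complex.exp ((z + a) * T) / (z + a)) := by
    intro a ha T hT
    simp only [hφ, Finset.mul_sum]
    rw [integral_finsetSum _ fun l hl =>
      integrableOn_circleExp hr hr (hcont l hl) (hre l hl) ha hT, ← Finset.sum_neg_distrib]
    exact Finset.sum_congr rfl fun l hl =>
      integral_Ioi_exp_mul_circleExp hr hr (hcont l hl) (hre l hl) ha hT
  have hchar : ∀ t : ℝ, charFun ν t =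
      ∫ x : ℝ, Complex.exp (t * x * Complex.I) * (Set.Ioi 0).indicator φ x := by
    intro t
    have h1 : ∀ x : ℝ, Complex.exp (t * x * Complex.I) * (Set.Ioi 0).indicator φ x =
        (Set.Ioi 0).indicator (fun x : ℝ => Complex.exp ((t * Complex.I) * x) * φ x) x := by
      intro x
      by_cases hx : x ∈ Set.Ioi (0 : ℝ)
      · rw [Set.indicator_of_mem hx, Set.indicator_of_mem hx]
        congr 2
        ring
      · rw [Set.indicator_of_notMem hx, Set.indicator_of_notMem hx, mul_zero]
    simp only [h1]
    rw [integral_indicator measurableSet_Ioi, hφlap _ (by simp) 0 le_rfl, hν, hpf]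
    simp [cauchyTransform]
  -- Having a density, the measure has no atom at τ; and τ ≥ 0 keeps the tail inside the support x >
  -- 0 of the density.
  have htail : (ν.real (Set.Ici τ) : ℂ) = ∫ x in Set.Ioi τ, φ x := by
    rw [ofReal_measureReal_eq_setIntegral_of_charFun
      (hφint.integrable_indicator measurableSet_Ioi) hchar measurableSet_Ici,
      integral_Ici_eq_integral_Ioi]
    exact setIntegral_congr_fun measurableSet_Ioi fun x hx =>
      Set.indicator_of_mem (hτ.trans_lt hx) _
  have hseries : ∀ l ∈ distinct Λ, HasSum (term τ Λ χ l) ((2 * Real.pi * Complex.I)⁻¹ *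
      ∮ w in C(0, r), g τ Λ χ l w * Complex.exp (((energy Λ χ l / l : ℝ) : ℂ) / w) /
        w ^ mult Λ l) := by
    intro l hl
    refine hasSum_circleIntegral_mul_exp_div hr (fun w hw => ?_) _ (mult_pos hl)
    rw [mem_closedBall, dist_zero_right] at hw
    refine (differentiableAt_g τ χ ?_ fun p hp => ?_).differentiableWithinAt
    · intro h
      rw [sub_eq_zero.1 h, ← Complex.ofReal_one, ← Complex.ofReal_div, Complex.norm_real,
        Real.norm_of_nonneg (one_div_pos.2 (hpos l hl)).le] at hw
      linarith [hε1 l hl]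
    · have hpD := Finset.mem_of_mem_erase hp
      refine one_add_mul_ne_zero (hpos p hpD) fun h => ?_
      have h1 : w = ((1 / l - 1 / p : ℝ) : ℂ) := by
        rw [sub_eq_iff_eq_add] at h
        rw [h]
        push_cast
        ring
      rw [h1, Complex.norm_real, Real.norm_eq_abs] at hw
      linarith [hε2 l hl p hpD (Finset.ne_of_mem_erase hp).symm]
  refine ⟨fun l hl => (hseries l hl).summable, ?_⟩
  have h0 := hφlap 0 le_rfl τ hτ
  simp only [zero_mul, Complex.exp_zero, one_mul, add_zero] at h0
  rw [htail, h0]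
  congr 1
  refine Finset.sum_congr rfl fun l hl => ?_
  rw [(hseries l hl).tsum_eq, circleIntegral_translate, mul_left_comm (Complex.exp _ / _),
    ← circleIntegral.integral_const_mul (Complex.exp _ / _)]
  congr 1
  refine circleIntegral.integral_congr hr.le fun w hw => ?_
  have hw0 : w ≠ 0 := fun h => hr.ne (by simpa [h] using hw)
  have h1 : pole l + w = w - 1 / l := by
    simp only [hpole]
    push_cast
    ring
  simp only [h1]
  exact laplace_mul_exp_div_eq τ χ (hpos l hl) hl hw0

end OutageSeries

/-! ### Scalar circular Gaussian laws. -/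

section CircularGaussian

theorem measurable_complexMk : Measurable fun p : ℝ × ℝ => (⟨p.1, p.2⟩ : ℂ) :=
  Complex.measurableEquivRealProd.symm.measurable

instance isProbabilityMeasure_circularGaussian (v : ℝ≥0) :
    IsProbabilityMeasure (circularGaussian v) :=
  Measure.isProbabilityMeasure_map measurable_complexMk.aemeasurable

theorem integral_circularGaussian (v : ℝ≥0) {f : ℂ → ℂ} (hf : Measurable f) :
    ∫ z, f z ∂circularGaussian v =
      ∫ p : ℝ × ℝ, f ⟨p.1, p.2⟩ ∂((gaussianReal 0 (v / 2)).prod (gaussianReal 0 (v / 2))) :=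
  integral_map measurable_complexMk.aemeasurable hf.aestronglyMeasurable

theorem charFun_circularGaussian (v : ℝ≥0) (ζ : ℂ) :
    charFun (circularGaussian v) ζ = Complex.exp (-(v * ‖ζ‖ ^ 2 / 4)) := by
  rw [charFun_apply, integral_circularGaussian v (by fun_prop)]
  have h1 : ∀ p : ℝ × ℝ, Complex.exp ((inner ℝ (⟨p.1, p.2⟩ : ℂ) ζ : ℝ) * Complex.I) =
      Complex.exp (ζ.re * p.1 * Complex.I) * Complex.exp (ζ.im * p.2 * Complex.I) := fun p => by
    rw [← Complex.exp_add, Complex.inner]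
    congr 1
    simp only [Complex.mul_re, Complex.conj_re, Complex.conj_im]
    push_cast
    ring
  simp only [h1]
  rw [integral_prod_mul (fun x : ℝ => Complex.exp (ζ.re * x * Complex.I))
    (fun x : ℝ => Complex.exp (ζ.im * x * Complex.I)), ← charFun_apply_real, ← charFun_apply_real,
    charFun_gaussianReal, charFun_gaussianReal, ← Complex.exp_add]
  congr 1
  rw [← Complex.ofReal_pow ‖ζ‖, ← Complex.normSq_eq_norm_sq, Complex.normSq_apply]
  push_cast
  ring

theorem memLp_id_circularGaussian (v : ℝ≥0) : MemLp id 2 (circularGaussian v) := by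
  rw [circularGaussian, memLp_map_measure_iff aestronglyMeasurable_id
    measurable_complexMk.aemeasurable]
  have h0 : MemLp (fun x : ℝ => (x : ℂ)) 2 (gaussianReal 0 (v / 2)) :=
    (memLp_id_gaussianReal' 2 (by simp)).ofReal
  have h1 := (h0.comp_fst (gaussianReal 0 (v / 2))).add
    ((h0.comp_snd (gaussianReal 0 (v / 2))).const_mul Complex.I)
  refine h1.ae_eq (Filter.Eventually.of_forall fun p => ?_)
  apply Complex.ext <;> simp

theorem integral_id_circularGaussian (v : ℝ≥0) : ∫ z, z ∂circularGaussian v = 0 := by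
  rw [integral_circularGaussian v (f := fun z => z) measurable_id]
  have h0 : Integrable (fun x : ℝ => (x : ℂ)) (gaussianReal 0 (v / 2)) :=
    ((memLp_id_gaussianReal' 1 (by simp)).integrable le_rfl).ofReal
  have h1 : ∀ p : ℝ × ℝ, (⟨p.1, p.2⟩ : ℂ) = p.1 + Complex.I * p.2 := fun p => by
    apply Complex.ext <;> simp
  have h2 : ∫ x : ℝ, (x : ℂ) ∂gaussianReal 0 (v / 2) = 0 := by
    rw [integral_complex_ofReal, integral_id_gaussianReal, Complex.ofReal_zero]
  simp only [h1]
  rw [integral_add (h0.comp_fst _) ((h0.comp_snd _).const_mul _), integral_const_mul,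
    integral_fun_fst (fun x : ℝ => (x : ℂ)), integral_fun_snd (fun x : ℝ => (x : ℂ)), h2]
  simp

theorem integral_mul_conj_circularGaussian (v : ℝ≥0) :
    ∫ z, z * star z ∂circularGaussian v = v := by
  rw [integral_circularGaussian v (by fun_prop)]
  have h0 : Integrable (fun x : ℝ => ((x ^ 2 : ℝ) : ℂ)) (gaussianReal 0 (v / 2)) :=
    (memLp_id_gaussianReal' 2 (by simp)).integrable_sq.ofReal
  have h1 : ∀ p : ℝ × ℝ, (⟨p.1, p.2⟩ : ℂ) * star (⟨p.1, p.2⟩ : ℂ) =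
      ((p.1 ^ 2 : ℝ) : ℂ) + ((p.2 ^ 2 : ℝ) : ℂ) := fun p => by
    apply Complex.ext <;> simp <;> simp [← Complex.ofReal_pow] <;> ring
  have h2 : ∫ x : ℝ, ((x ^ 2 : ℝ) : ℂ) ∂gaussianReal 0 (v / 2) = v / 2 := by
    rw [integral_complex_ofReal, ← variance_of_integral_eq_zero (X := fun x : ℝ => x)
      (by fun_prop) integral_id_gaussianReal, variance_fun_id_gaussianReal]
    simp
  simp only [h1]
  rw [integral_add (h0.comp_fst _) (h0.comp_snd _),
    integral_fun_fst (fun x : ℝ => ((x ^ 2 : ℝ) : ℂ)),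
    integral_fun_snd (fun x : ℝ => ((x ^ 2 : ℝ) : ℂ)), h2]
  simp

/-- Complete the square in the Gaussian integral. The complex square root is left unevaluated: only
its square occurs once real and imaginary parts are multiplied, so no branch has to be determined.
-/
theorem integral_cexp_shift_sq_gaussianReal {v : ℝ≥0} (hv : v ≠ 0) (t α : ℝ) :
    ∫ x : ℝ, Complex.exp (t * (x + α) ^ 2 * Complex.I) ∂gaussianReal 0 (v / 2) =
      ((√(Real.pi * v))⁻¹ : ℝ) * (Real.pi / -(t * Complex.I - 1 / v)) ^ (1 / 2 : ℂ) *
        Complex.exp (t * α ^ 2 * Complex.I / (1 - t * v * Complex.I)) := by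
  have hv0 : (v : ℂ) ≠ 0 := by exact_mod_cast hv
  have hvpos : (0 : ℝ) < v := by positivity
  have hb : (t * Complex.I - 1 / v : ℂ).re < 0 := by
    have : ((1 : ℂ) / (v : ℂ)) = ((1 / v : ℝ) : ℂ) := by push_cast; rfl
    rw [this, Complex.sub_re, Complex.ofReal_re]
    simpa using hvpos
  have hden : (1 - t * v * Complex.I : ℂ) ≠ 0 := fun h => by
    have := congrArg Complex.re h
    simp at this
  rw [integral_gaussianReal_eq_integral_smul (by positivity)]
  have h1 : ∀ x : ℝ, gaussianPDFReal 0 (v / 2) x • Complex.exp (t * (x + α) ^ 2 * Complex.I) =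
      ((√(Real.pi * v))⁻¹ : ℝ) * Complex.exp ((t * Complex.I - 1 / v) * x ^ 2 +
        (2 * t * α * Complex.I) * x + t * α ^ 2 * Complex.I) := fun x => by
    have h2 : (2 * Real.pi * ((v / 2 : ℝ≥0) : ℝ)) = Real.pi * v := by push_cast; ring
    rw [gaussianPDFReal, h2, Complex.real_smul, Complex.ofReal_mul, Complex.ofReal_exp, mul_assoc,
      ← Complex.exp_add]
    congr 2
    push_cast
    field_simp
    ring
  simp only [h1]
  rw [integral_const_mul, integral_cexp_quadratic hb, ← mul_assoc]
  congr 2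
  have h3 : (t * Complex.I - 1 / v : ℂ) = -(1 - t * v * Complex.I) / v := by
    field_simp
    ring
  rw [h3, eq_div_iff hden]
  have h4 : (2 * t * α * Complex.I) ^ 2 / (4 * (-(1 - t * v * Complex.I) / v)) =
      -((t * α * Complex.I) ^ 2 * v) / (1 - t * v * Complex.I) := by
    generalize (1 - t * v * Complex.I : ℂ) = D at *
    field_simp
    ring
  rw [h4, sub_mul, div_mul_cancel₀ _ hden]
  ring

theorem charFun_norm_sq_circularGaussian {v : ℝ≥0} (hv : v ≠ 0) (t : ℝ) (a : ℂ) :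
    ∫ z : ℂ, Complex.exp (t * ((‖z + a‖ ^ 2 : ℝ) : ℂ) * Complex.I) ∂circularGaussian v =
      Complex.exp (t * ((‖a‖ ^ 2 : ℝ) : ℂ) * Complex.I / (1 - t * v * Complex.I)) /
        (1 - t * v * Complex.I) := by
  rw [integral_circularGaussian v (by fun_prop)]
  have hv0 : (v : ℂ) ≠ 0 := by exact_mod_cast hv
  have hvpos : (0 : ℝ) < v := by positivity
  have hpi : (Real.pi : ℂ) ≠ 0 := by exact_mod_cast Real.pi_ne_zero
  have hden : (1 - t * v * Complex.I : ℂ) ≠ 0 := fun h => by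
    have := congrArg Complex.re h
    simp at this
  have h1 : ∀ p : ℝ × ℝ, Complex.exp (t * ((‖(⟨p.1, p.2⟩ : ℂ) + a‖ ^ 2 : ℝ) : ℂ) * Complex.I) =
      Complex.exp (t * (p.1 + a.re) ^ 2 * Complex.I) *
        Complex.exp (t * (p.2 + a.im) ^ 2 * Complex.I) := fun p => by
    rw [← Complex.exp_add, ← Complex.normSq_eq_norm_sq, Complex.normSq_apply]
    congr 1
    simp only [Complex.add_re, Complex.add_im]
    push_cast
    ring
  simp only [h1]
  rw [integral_prod_mul (fun x : ℝ => Complex.exp (t * (x + a.re) ^ 2 * Complex.I))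
    (fun x : ℝ => Complex.exp (t * (x + a.im) ^ 2 * Complex.I)),
    integral_cexp_shift_sq_gaussianReal hv, integral_cexp_shift_sq_gaussianReal hv]
  set c : ℂ := (Real.pi / -(t * Complex.I - 1 / v)) ^ (1 / 2 : ℂ) with hc
  have hcc : c * c = Real.pi * v / (1 - t * v * Complex.I) := by
    have h2 : c * c = c ^ 2 := (sq c).symm
    have h3 : (1 / 2 : ℂ) = ((2 : ℕ) : ℂ)⁻¹ := by norm_num
    rw [h2, hc, h3, Complex.cpow_nat_inv_pow _ two_ne_zero]
    have h4 : (-(t * Complex.I - 1 / v) : ℂ) = (1 - t * v * Complex.I) / v := by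
      field_simp
      ring
    rw [h4]
    field_simp
  have hss : (((√(Real.pi * v))⁻¹ : ℝ) : ℂ) * (((√(Real.pi * v))⁻¹ : ℝ) : ℂ) =
      (Real.pi * v : ℂ)⁻¹ := by
    rw [← Complex.ofReal_mul, ← mul_inv, Real.mul_self_sqrt (by positivity)]
    push_cast
    rfl
  have hE : Complex.exp (t * a.re ^ 2 * Complex.I / (1 - t * v * Complex.I)) *
      Complex.exp (t * a.im ^ 2 * Complex.I / (1 - t * v * Complex.I)) =
      Complex.exp (t * ((‖a‖ ^ 2 : ℝ) : ℂ) * Complex.I / (1 - t * v * Complex.I)) := by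
    rw [← Complex.exp_add, ← Complex.normSq_eq_norm_sq, Complex.normSq_apply]
    congr 1
    push_cast
    ring
  rw [← hE]
  calc _ = ((((√(Real.pi * v))⁻¹ : ℝ) : ℂ) * (((√(Real.pi * v))⁻¹ : ℝ) : ℂ)) * (c * c) *
      (Complex.exp (t * a.re ^ 2 * Complex.I / (1 - t * v * Complex.I)) *
      Complex.exp (t * a.im ^ 2 * Complex.I / (1 - t * v * Complex.I))) := by ring
    _ = _ := by
      rw [hss, hcc]
      field_simp

variable {Ω : Type*} [MeasurableSpace Ω] {P : Measure Ω}

/-- The characteristic function depends only on the modulus of its argument, so the phase of c has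
no effect and only |c|² rescales the variance. -/
theorem hasLaw_circularGaussian_const_mul {Z : Ω → ℂ} {v : ℝ≥0}
    (hZ : HasLaw Z (circularGaussian v) P) (c : ℂ) :
    HasLaw (fun ω => c * Z ω) (circularGaussian (‖c‖₊ ^ 2 * v)) P := by
  have hP : IsProbabilityMeasure P := hZ.isProbabilityMeasure
  refine ⟨hZ.aemeasurable.const_mul c, ?_⟩
  have : IsProbabilityMeasure (P.map fun ω => c * Z ω) :=
    Measure.isProbabilityMeasure_map (hZ.aemeasurable.const_mul c)
  refine Measure.ext_of_charFun (funext fun ζ => ?_)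
  have h1 : charFun (P.map fun ω => c * Z ω) ζ =
      charFun (circularGaussian v) ((starRingEnd ℂ) c * ζ) := by
    rw [← hZ.map_eq, charFun_apply, charFun_apply,
      integral_map (hZ.aemeasurable.const_mul c) (by fun_prop),
      integral_map hZ.aemeasurable (by fun_prop)]
    refine integral_congr_ae (Filter.Eventually.of_forall fun ω => ?_)
    simp only [Complex.inner, map_mul]
    congr 4
    ring
  rw [h1, charFun_circularGaussian, charFun_circularGaussian, norm_mul, RCLike.norm_conj]
  congr 1
  push_cast
  ring

theorem hasLaw_circularGaussian_sum {κ : Type*} [Fintype κ] {Z : κ → Ω → ℂ} {v : κ → ℝ≥0}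
    [IsProbabilityMeasure P]
    (hZ : ∀ i, HasLaw (Z i) (circularGaussian (v i)) P) (hind : iIndepFun Z P) :
    HasLaw (fun ω => ∑ i, Z i ω) (circularGaussian (∑ i, v i)) P := by
  have hm : AEMeasurable (fun ω => ∑ i, Z i ω) P :=
    Finset.aemeasurable_fun_sum _ fun i _ => (hZ i).aemeasurable
  refine ⟨hm, ?_⟩
  have : IsProbabilityMeasure (P.map fun ω => ∑ i, Z i ω) := Measure.isProbabilityMeasure_map hm
  refine Measure.ext_of_charFun (funext fun ζ => ?_)
  rw [hind.charFun_map_fun_sum_eq_prod fun i => (hZ i).aemeasurable, Finset.prod_apply,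
    charFun_circularGaussian]
  simp only [(hZ _).map_eq, charFun_circularGaussian]
  rw [← Complex.exp_sum]
  congr 1
  push_cast
  rw [Finset.sum_neg_distrib, Finset.sum_mul, Finset.sum_div]

/-- Every linear functional of independent circular Gaussian coordinates is circular Gaussian. -/
theorem exists_hasLaw_circularGaussian_linearMap {κ : Type*} [Fintype κ] [IsProbabilityMeasure P]
    {w : Ω → κ → ℂ} {v : ℝ≥0} (hw : HasLaw w (Measure.pi fun _ : κ => circularGaussian v) P)
    (L : (κ → ℂ) →ₗ[ℂ] ℂ) : ∃ u : ℝ≥0, HasLaw (fun ω => L (w ω)) (circularGaussian u) P := by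
  classical
  have hcoord : ∀ b, HasLaw (fun x : κ → ℂ => x b) (circularGaussian v)
      (Measure.pi fun _ : κ => circularGaussian v) := fun b =>
    (measurePreserving_eval (fun _ : κ => circularGaussian v) b).hasLaw
  have hind : iIndepFun (fun (b : κ) (x : κ → ℂ) => L (Pi.single b 1) * x b)
      (Measure.pi fun _ : κ => circularGaussian v) :=
    iIndepFun_pi (X := fun b (z : ℂ) => L (Pi.single b 1) * z) fun b => by fun_prop
  have hsum := hasLaw_circularGaussian_sum
    (fun b => hasLaw_circularGaussian_const_mul (hcoord b) (L (Pi.single b 1))) hind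
  refine ⟨_, (hsum.fun_comp hw).congr (Filter.Eventually.of_forall fun ω => ?_)⟩
  simp only
  conv_lhs => rw [← Finset.univ_sum_single (w ω), map_sum]
  refine Finset.sum_congr rfl fun b _ => ?_
  have : Pi.single b (w ω b) = w ω b • (Pi.single b (1 : ℂ) : κ → ℂ) := by
    rw [← Pi.single_smul, smul_eq_mul, mul_one]
  rw [this, map_smul, smul_eq_mul, mul_comm]

end CircularGaussian

/-! ### Circular Gaussian vectors and their squared norm. -/

section CircularGaussianVector

variable {ι Ω : Type*} [Fintype ι] [MeasurableSpace Ω] {P : Measure Ω}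

/-- A random vector is centred circular Gaussian if every complex-linear functional of it is. -/
def IsCircularGaussianVector (P : Measure Ω) (Z : ι → Ω → ℂ) : Prop :=
  ∀ c : ι → ℂ, ∃ v : ℝ≥0, HasLaw (fun ω => ∑ a, c a * Z a ω) (circularGaussian v) P

theorem memLp_of_hasLaw_circularGaussian {Z : Ω → ℂ} {v : ℝ≥0}
    (hZ : HasLaw Z (circularGaussian v) P) : MemLp Z 2 P := by
  have h := memLp_id_circularGaussian v
  rw [← hZ.map_eq, memLp_map_measure_iff aestronglyMeasurable_id hZ.aemeasurable] at h
  exact h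

namespace IsCircularGaussianVector

variable {Z : ι → Ω → ℂ} (hZ : IsCircularGaussianVector P Z)

include hZ

theorem exists_hasLaw (a : ι) : ∃ v : ℝ≥0, HasLaw (Z a) (circularGaussian v) P := by
  classical
  obtain ⟨v, hv⟩ := hZ (Pi.single a 1)
  refine ⟨v, hv.congr (Filter.Eventually.of_forall fun ω => ?_)⟩
  simp [Pi.single_apply]

theorem memLp (a : ι) : MemLp (Z a) 2 P := by
  obtain ⟨v, hv⟩ := hZ.exists_hasLaw a
  exact memLp_of_hasLaw_circularGaussian hv

theorem integral_eq_zero (a : ι) : ∫ ω, Z a ω ∂P = 0 := by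
  obtain ⟨v, hv⟩ := hZ.exists_hasLaw a
  rw [hv.integral_eq, integral_id_circularGaussian]

theorem integrable_mul_star (a b : ι) : Integrable (fun ω => Z a ω * star (Z b ω)) P :=
  (hZ.memLp a).integrable_mul (hZ.memLp b).star

theorem linear {κ : Type*} [Fintype κ] (A : κ → ι → ℂ) :
    IsCircularGaussianVector P fun b ω => ∑ a, A b a * Z a ω := fun c => by
  obtain ⟨v, hv⟩ := hZ fun a => ∑ b, c b * A b a
  refine ⟨v, hv.congr (Filter.Eventually.of_forall fun ω => ?_)⟩
  simp only [Finset.mul_sum, Finset.sum_mul]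
  rw [Finset.sum_comm]
  exact Finset.sum_congr rfl fun a _ => Finset.sum_congr rfl fun b _ => by ring

theorem integral_sum_mul_star (c e : ι → ℂ) :
    ∫ ω, (∑ a, c a * Z a ω) * star (∑ b, e b * Z b ω) ∂P =
      ∑ a, ∑ b, c a * star (e b) * ∫ ω, Z a ω * star (Z b ω) ∂P := by
  have h1 : ∀ ω, (∑ a, c a * Z a ω) * star (∑ b, e b * Z b ω) =
      ∑ a, ∑ b, c a * star (e b) * (Z a ω * star (Z b ω)) := fun ω => by
    rw [star_sum, Finset.sum_mul_sum]
    refine Finset.sum_congr rfl fun a _ => Finset.sum_congr rfl fun b _ => ?_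
    rw [star_mul']
    ring
  simp only [h1]
  have hi : ∀ a b, Integrable (fun ω => c a * star (e b) * (Z a ω * star (Z b ω))) P :=
    fun a b => (hZ.integrable_mul_star a b).const_mul _
  rw [integral_finsetSum _ fun a _ => integrable_finsetSum _ fun b _ => hi a b]
  refine Finset.sum_congr rfl fun a _ => ?_
  rw [integral_finsetSum _ fun b _ => hi a b]
  simp only [integral_const_mul]

/-- A circular Gaussian vector with diagonal covariance has independent coordinates. -/
theorem hasLaw_and_iIndepFun_of_diagonal [DecidableEq ι] [IsProbabilityMeasure P] {v : ι → ℝ≥0}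
    (hcov : ∀ a b, ∫ ω, Z a ω * star (Z b ω) ∂P = if a = b then (v a : ℂ) else 0) :
    (∀ a, HasLaw (Z a) (circularGaussian (v a)) P) ∧ iIndepFun Z P := by
  -- The variance of each functional, whose existence is part of the definition, is read off from
  -- its second absolute moment, computed with the diagonal covariance.
  have hvar : ∀ c : ι → ℂ, HasLaw (fun ω => ∑ a, c a * Z a ω)
      (circularGaussian (∑ a, ‖c a‖₊ ^ 2 * v a)) P := fun c => by
    obtain ⟨u, hu⟩ := hZ c
    have h1 := hZ.integral_sum_mul_star c c
    simp only [hcov, mul_ite, mul_zero, Finset.sum_ite_eq, Finset.mem_univ, if_true] at h1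
    have h2 := hu.integral_comp (f := fun z => z * star z) (by fun_prop)
    simp only [Function.comp_def] at h2
    rw [h1, integral_mul_conj_circularGaussian] at h2
    have h3 : u = ∑ a, ‖c a‖₊ ^ 2 * v a := by
      have h4 : (((∑ a, ‖c a‖₊ ^ 2 * v a : ℝ≥0) : ℝ) : ℂ) = ((u : ℝ) : ℂ) := by
        rw [← h2]
        push_cast
        refine Finset.sum_congr rfl fun a _ => ?_
        have := Complex.mul_conj' (c a)
        rw [Complex.star_def, this]
      exact (NNReal.coe_injective (Complex.ofReal_injective h4)).symm
    exact h3 ▸ hu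
  have hlaw : ∀ a, HasLaw (Z a) (circularGaussian (v a)) P := fun a => by
    have h1 := hvar (Pi.single a 1)
    have h2 : ∑ b, ‖(Pi.single a 1 : ι → ℂ) b‖₊ ^ 2 * v b = v a := by
      rw [Finset.sum_eq_single a] <;> simp +contextual
    rw [h2] at h1
    refine h1.congr (Filter.Eventually.of_forall fun ω => ?_)
    simp [Pi.single_apply]
  refine ⟨hlaw, (iIndepFun_iff_charFun_pi fun a => (hlaw a).aemeasurable).2 fun t => ?_⟩
  have h1 := congrArg (fun μ : Measure ℂ => charFun μ 1) (hvar fun a => star (t a)).map_eq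
  simp only at h1
  rw [charFun_circularGaussian] at h1
  simp only [(hlaw _).map_eq, charFun_circularGaussian]
  have hm : AEMeasurable (fun ω => WithLp.toLp 2 fun a => Z a ω) P :=
    (WithLp.measurable_toLp 2 _).comp_aemeasurable
      (aemeasurable_pi_lambda _ fun a => (hlaw a).aemeasurable)
  -- Cramér–Wold: the joint characteristic function at t is that of the scalar ∑ conj(t_a) Z_a at 1.
  -- It then factors over the coordinates, which is independence.
  have h2 : charFun (P.map fun ω => WithLp.toLp 2 fun a => Z a ω) t =
      charFun (P.map fun ω => ∑ a, star (t a) * Z a ω) 1 := by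
    rw [charFun_apply, charFun_apply, integral_map hm (by fun_prop),
      integral_map (hvar fun a => star (t a)).aemeasurable (by fun_prop)]
    refine integral_congr_ae (Filter.Eventually.of_forall fun ω => ?_)
    have h3 : inner ℝ (WithLp.toLp 2 fun a => Z a ω) t =
        inner ℝ (∑ a, star (t a) * Z a ω) (1 : ℂ) := by
      rw [PiLp.inner_apply, sum_inner]
      refine Finset.sum_congr rfl fun a _ => ?_
      rw [Complex.inner, Complex.inner, map_mul, one_mul, Complex.star_def, Complex.conj_conj]
    simp only [h3]
  rw [h2, h1, ← Complex.exp_sum]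
  congr 1
  push_cast
  rw [Finset.sum_neg_distrib, ← Finset.sum_div]
  congr 2
  simp only [norm_star, norm_one]
  rw [Complex.ofReal_one, one_pow, mul_one]
  exact Finset.sum_congr rfl fun a _ => mul_comm _ _

end IsCircularGaussianVector

theorem sum_norm_sq_conjTranspose_mulVec [DecidableEq ι] {Ψ : Matrix ι ι ℂ}
    (hΨ : Ψ ∈ Matrix.unitaryGroup ι ℂ) (x : ι → ℂ) :
    ∑ b, ‖(Ψᴴ *ᵥ x) b‖ ^ 2 = ∑ a, ‖x a‖ ^ 2 := by
  have h0 : ∀ y : ι → ℂ, ((∑ a, ‖y a‖ ^ 2 : ℝ) : ℂ) = star y ⬝ᵥ y := fun y => by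
    simp only [dotProduct, Pi.star_apply, Complex.star_def, Complex.conj_mul']
    push_cast
    rfl
  have h1 : Ψ * Ψᴴ = 1 := Matrix.mem_unitaryGroup_iff.1 hΨ
  have h2 : star (Ψᴴ *ᵥ x) ⬝ᵥ (Ψᴴ *ᵥ x) = star x ⬝ᵥ x := by
    rw [Matrix.star_mulVec, Matrix.conjTranspose_conjTranspose, ← Matrix.dotProduct_mulVec,
      Matrix.mulVec_mulVec, h1, Matrix.one_mulVec]
  exact_mod_cast (h0 _).trans (h2.trans (h0 _).symm)

namespace OutageSeries

theorem prod_distinct {M : Type*} [CommMonoid M] (Λ : ι → ℝ) (f : ι → M) :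
    ∏ p ∈ distinct Λ, ∏ a ∈ Finset.univ.filter (fun a => Λ a = p), f a = ∏ a, f a :=
  Finset.prod_fiberwise_of_maps_to (fun _ ha => Finset.mem_image_of_mem Λ ha) f

theorem sum_distinct {M : Type*} [AddCommMonoid M] (Λ : ι → ℝ) (f : ι → M) :
    ∑ p ∈ distinct Λ, ∑ a ∈ Finset.univ.filter (fun a => Λ a = p), f a = ∑ a, f a :=
  Finset.sum_fiberwise_of_maps_to (fun _ ha => Finset.mem_image_of_mem Λ ha) f

/-- Ungroups equal eigenvalues, so that the factors match the independent coordinates. -/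
theorem laplace_eq_prod (Λ : ι → ℝ) (χ : ι → ℂ) (s : ℂ) :
    laplace Λ χ s = ∏ a, Complex.exp (-(s * Λ a / (1 + s * Λ a) * ((‖χ a‖ ^ 2 : ℝ) : ℂ))) /
      (1 + s * Λ a) := by
  rw [Finset.prod_div_distrib, ← Complex.exp_sum, laplace, ← prod_distinct Λ,
    ← sum_distinct Λ, ← Finset.sum_neg_distrib]
  congr 1
  · congr 1
    refine Finset.sum_congr rfl fun p _ => ?_
    rw [energy, Complex.ofReal_sum, Finset.mul_sum, ← Finset.sum_neg_distrib]
    refine Finset.sum_congr rfl fun a ha => ?_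
    rw [(Finset.mem_filter.1 ha).2]
  · refine Finset.prod_congr rfl fun p _ => ?_
    rw [Finset.prod_congr rfl fun a ha => by rw [(Finset.mem_filter.1 ha).2], Finset.prod_const,
      mult]

/-- The covariance eigenvalues of a random vector with nonsingular covariance are positive, and
its squared norm has characteristic function given by `laplace`. -/
theorem charFun_sum_norm_sq [DecidableEq ι] [IsProbabilityMeasure P] {Z : ι → Ω → ℂ}
    (hZ : IsCircularGaussianVector P Z) (μ : ι → ℂ) {Ψ : Matrix ι ι ℂ}
    (hΨ : Ψ ∈ Matrix.unitaryGroup ι ℂ) {Λ : ι → ℝ}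
    (hcov : (Matrix.of fun a b => ∫ ω, Z a ω * star (Z b ω) ∂P) =
      Ψ * Matrix.diagonal (fun a => (Λ a : ℂ)) * Ψᴴ)
    (hdet : (Matrix.of fun a b => ∫ ω, Z a ω * star (Z b ω) ∂P).det ≠ 0) :
    (∀ a, 0 < Λ a) ∧ ∀ t : ℝ, charFun (P.map fun ω => ∑ a, ‖Z a ω + μ a‖ ^ 2) t =
      laplace Λ (chi Ψ Λ μ) (-(t * Complex.I)) := by
  -- Y = Ψᴴ Z has covariance Ψᴴ Σ Ψ = Λ, hence independent coordinates.
  set Y : ι → Ω → ℂ := fun b ω => ∑ a, star (Ψ a b) * Z a ω with hY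
  have hYG : IsCircularGaussianVector P Y := hZ.linear _
  have hunit : Ψᴴ * Ψ = 1 := Matrix.mem_unitaryGroup_iff'.1 hΨ
  have hYcov : ∀ a b, ∫ ω, Y a ω * star (Y b ω) ∂P = if a = b then (Λ a : ℂ) else 0 := by
    intro a b
    have h1 : Ψᴴ * (Matrix.of fun a b => ∫ ω, Z a ω * star (Z b ω) ∂P) * Ψ =
        Matrix.diagonal (fun a => (Λ a : ℂ)) := by
      rw [hcov, ← Matrix.mul_assoc, ← Matrix.mul_assoc, hunit, Matrix.one_mul, Matrix.mul_assoc,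
        hunit, Matrix.mul_one]
    rw [← Matrix.diagonal_apply (d := fun a => (Λ a : ℂ)), ← h1, hY,
      hZ.integral_sum_mul_star, Matrix.mul_apply,
      Finset.sum_comm]
    refine Finset.sum_congr rfl fun d _ => ?_
    rw [Matrix.mul_apply, Finset.sum_mul]
    refine Finset.sum_congr rfl fun c _ => ?_
    rw [star_star, Matrix.conjTranspose_apply, Matrix.of_apply]
    ring
  -- Each Λ a is the variance of Y a, hence nonnegative, and a zero would make the determinant
  -- vanish.
  have hΛ : ∀ a, 0 < Λ a := by
    intro a
    have hnonneg : 0 ≤ Λ a := by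
      obtain ⟨v, hv⟩ := hYG.exists_hasLaw a
      have h2 := hv.integral_comp (f := fun z => z * star z) (by fun_prop)
      simp only [Function.comp_def] at h2
      rw [hYcov, if_pos rfl, integral_mul_conj_circularGaussian] at h2
      have h3 : Λ a = (v : ℝ) := Complex.ofReal_injective h2
      exact h3 ▸ v.coe_nonneg
    refine lt_of_le_of_ne hnonneg fun h0 => hdet ?_
    rw [hcov, Matrix.det_mul, Matrix.det_mul, Matrix.det_diagonal,
      Finset.prod_eq_zero (Finset.mem_univ a) (by rw [← h0, Complex.ofReal_zero]), mul_zero,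
      zero_mul]
  refine ⟨hΛ, fun t => ?_⟩
  have hYcov' : ∀ a b, ∫ ω, Y a ω * star (Y b ω) ∂P =
      if a = b then (((Λ a).toNNReal : ℝ) : ℂ) else 0 := by
    simpa only [Real.coe_toNNReal _ (hΛ _).le] using hYcov
  obtain ⟨hlaw, hind⟩ := hYG.hasLaw_and_iIndepFun_of_diagonal
    (v := fun a => (Λ a).toNNReal) hYcov'
  have hnorm : (fun ω => ∑ a, ‖Z a ω + μ a‖ ^ 2) =
      fun ω => ∑ b, ‖Y b ω + (Ψᴴ *ᵥ μ) b‖ ^ 2 := by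
    funext ω
    rw [← sum_norm_sq_conjTranspose_mulVec hΨ fun a => Z a ω + μ a]
    refine Finset.sum_congr rfl fun b _ => ?_
    congr 2
    simp only [Matrix.mulVec, dotProduct, Matrix.conjTranspose_apply, mul_add,
      Finset.sum_add_distrib, hY]
  have hm : ∀ b, AEMeasurable (fun ω => ‖Y b ω + (Ψᴴ *ᵥ μ) b‖ ^ 2) P := fun b =>
    (((hlaw b).aemeasurable.add_const _).norm).pow_const 2
  have hind2 : iIndepFun (fun b ω => ‖Y b ω + (Ψᴴ *ᵥ μ) b‖ ^ 2) P :=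
    hind.comp (fun b z => ‖z + (Ψᴴ *ᵥ μ) b‖ ^ 2) fun b => by fun_prop
  rw [hnorm, hind2.charFun_map_fun_sum_eq_prod hm, Finset.prod_apply, laplace_eq_prod]
  refine Finset.prod_congr rfl fun b _ => ?_
  have hb : (Λ b).toNNReal ≠ 0 := (Real.toNNReal_pos.2 (hΛ b)).ne'
  have h1 := charFun_norm_sq_circularGaussian hb t ((Ψᴴ *ᵥ μ) b)
  rw [← (hlaw b).map_eq, integral_map (hlaw b).aemeasurable (by fun_prop),
    Real.coe_toNNReal _ (hΛ b).le] at h1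
  rw [charFun_apply_real, integral_map (hm b) (by fun_prop), h1]
  have hden : (1 + -(t * Complex.I) * Λ b : ℂ) = 1 - t * Λ b * Complex.I := by ring
  have hchi : ‖(Ψᴴ *ᵥ μ) b‖ ^ 2 = Λ b * ‖chi Ψ Λ μ b‖ ^ 2 := by
    rw [chi, norm_mul, mul_pow, Complex.norm_real, Real.norm_eq_abs, sq_abs, inv_pow,
      Real.sq_sqrt (hΛ b).le, mul_inv_cancel_left₀ (hΛ b).ne']
  rw [hden, hchi]
  congr 2
  push_cast
  ring

end OutageSeries

end CircularGaussianVector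

/-! ### Linear maps that express the entries of X through the vectorized errors. -/

section MatrixFunctionals

variable {m n p q κ : Type*} [Fintype m] [Fintype n] [Fintype κ]

/-- The inverse of `Matrix.vec`, as a linear map. -/
def unvecLinear (m n : Type*) : (n × m → ℂ) →ₗ[ℂ] Matrix m n ℂ where
  toFun e := Matrix.of fun x y => e (y, x)
  map_add' _ _ := rfl
  map_smul' _ _ := rfl

/-- Multiplication by fixed matrices on both sides, as a linear map. -/
def sandwichLinear (A : Matrix p m ℂ) (B : Matrix n q ℂ) : Matrix m n ℂ →ₗ[ℂ] Matrix p q ℂ where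
  toFun M := A * M * B
  map_add' M N := by rw [Matrix.mul_add, Matrix.add_mul]
  map_smul' c M := by rw [Matrix.mul_smul, Matrix.smul_mul, RingHom.id_apply]

/-- A linear combination of the functionals `M ↦ u ⬝ᵥ M *ᵥ v j`. -/
def bilinearSumLinear (u : m → ℂ) (v : κ → n → ℂ) (c : κ → ℂ) : Matrix m n ℂ →ₗ[ℂ] ℂ where
  toFun M := ∑ j, c j * (u ⬝ᵥ (M *ᵥ v j))
  map_add' M N := by
    simp only [Matrix.add_mulVec, dotProduct_add, mul_add, Finset.sum_add_distrib]
  map_smul' a M := by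
    simp only [Matrix.smul_mulVec, dotProduct_smul, smul_eq_mul, Finset.mul_sum,
      RingHom.id_apply, mul_left_comm]

end MatrixFunctionals

/-! ### Reduction of the channel model to a Gaussian quadratic form. -/

namespace InterferenceChannel

variable {K d Nt Nr : ℕ} (S : InterferenceChannel K d Nt Nr) {Ω : Type*}

/-- The contribution of the channel error to the entries of `X`. -/
noncomputable def errorPart (W : Fin K → Fin K → Ω → Matrix (Fin Nr) (Fin Nt) ℂ)
    (k : Fin K) (m : Fin d) (a : Fin K × Fin d) (ω : Ω) : ℂ :=
  star (S.u k m) ⬝ᵥ (S.err W k a.1 ω *ᵥ S.v a.1 a.2)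

/-- The contribution of the channel estimate to the entries of `X`. -/
noncomputable def estimatePart (k : Fin K) (m : Fin d) (a : Fin K × Fin d) : ℂ :=
  if a.1 = k ∧ a.2 = m then 0 else star (S.u k m) ⬝ᵥ (S.Hhat k a.1 *ᵥ S.v a.1 a.2)

theorem X_eq_errorPart_add_estimatePart (W : Fin K → Fin K → Ω → Matrix (Fin Nr) (Fin Nt) ℂ)
    (k : Fin K) (m : Fin d) (ω : Ω) (a : Fin K × Fin d) :
    S.X W k m ω a = S.errorPart W k m a ω + S.estimatePart k m a := by
  unfold X errorPart estimatePart
  split_ifs with h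
  · rw [h.1, h.2, add_zero]
  · rw [Matrix.add_mulVec, dotProduct_add, add_comm]

theorem sinr_eq (W : Fin K → Fin K → Ω → Matrix (Fin Nr) (Fin Nt) ℂ)
    (k : Fin K) (m : Fin d) (ω : Ω) :
    S.sinr W k m ω = S.signalPower k m / (∑ a, ‖S.X W k m ω a‖ ^ 2 + S.noiseVar) := by
  rw [sinr]
  congr 2
  rw [Fintype.sum_prod_type, ← Finset.add_sum_erase _ _ (Finset.mem_univ k),
    ← Finset.add_sum_erase Finset.univ (fun j => ‖S.X W k m ω (k, j)‖ ^ 2) (Finset.mem_univ m)]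
  congr 1
  · congr 1
    · simp [X]
    · refine Finset.sum_congr rfl fun j hj => ?_
      simp [X, Finset.ne_of_mem_erase hj]
  · refine Finset.sum_congr rfl fun i hi => Finset.sum_congr rfl fun j _ => ?_
    simp [X, Finset.ne_of_mem_erase hi]

/-- Both σ² > 0 and 2^R > 1 are used: the denominators of the SINR and of τ are positive, so
clearing them preserves the inequality. -/
theorem logb_one_add_sinr_le_iff (hnoise : 0 < S.noiseVar)
    (W : Fin K → Fin K → Ω → Matrix (Fin Nr) (Fin Nt) ℂ) (k : Fin K) (m : Fin d) {R : ℝ}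
    (hR : 0 < R) (ω : Ω) :
    Real.logb 2 (1 + S.sinr W k m ω) ≤ R ↔ S.tau k m R ≤ ∑ a, ‖S.X W k m ω a‖ ^ 2 := by
  have hD : 0 < ∑ a, ‖S.X W k m ω a‖ ^ 2 + S.noiseVar := by positivity
  have hs : 0 ≤ S.signalPower k m := sq_nonneg _
  have h2R : 0 < (2 : ℝ) ^ R - 1 := sub_pos.2 (Real.one_lt_rpow one_lt_two hR)
  rw [sinr_eq, Real.logb_le_iff_le_rpow one_lt_two (by positivity), ← le_sub_iff_add_le',
    div_le_iff₀ hD, tau, sub_le_iff_le_add, div_le_iff₀' h2R]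

variable [MeasurableSpace Ω] {P : Measure Ω} [IsProbabilityMeasure P]
  {W : Fin K → Fin K → Ω → Matrix (Fin Nr) (Fin Nt) ℂ}

/-- A linear functional of the error part splits by transmitter. Each piece is a linear functional
of a single vec(W_ki), hence circular Gaussian, and the pieces are independent across i for the
fixed receiver k, so their sum is circular Gaussian. -/
theorem isCircularGaussianVector_errorPart (hW : S.KroneckerErrorModel P W)
    (k : Fin K) (m : Fin d) : IsCircularGaussianVector P (S.errorPart W k m) := by
  intro c
  set F : Fin K → Matrix (Fin Nr) (Fin Nt) ℂ →ₗ[ℂ] ℂ := fun i =>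
    bilinearSumLinear (star (S.u k m)) (S.v i) fun j => c (i, j) with hF
  have hlaw : ∀ i, ∃ v : ℝ≥0, HasLaw (fun ω => F i (S.err W k i ω)) (circularGaussian v) P :=
    fun i => exists_hasLaw_circularGaussian_linearMap (hW.1 k i)
      (F i ∘ₗ sandwichLinear (CFC.sqrt S.Sigmar) (CFC.sqrt S.Sigmat) ∘ₗ unvecLinear _ _)
  choose v hv using hlaw
  -- Independence is assumed for the correlated errors E_ki rather than for the W_ki, so here the
  -- functionals are factored through vec(E_ki).
  have hind : iIndepFun (fun i ω => F i (S.err W k i ω)) P :=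
    (hW.2.precomp (g := fun i : Fin K => (k, i)) fun i j h => (Prod.mk.inj h).2).comp
      (fun i => F i ∘ₗ unvecLinear _ _)
      fun i => (LinearMap.continuous_of_finiteDimensional _).measurable
  refine ⟨_, (hasLaw_circularGaussian_sum hv hind).congr (Filter.Eventually.of_forall fun ω => ?_)⟩
  exact Fintype.sum_prod_type fun a : Fin K × Fin d => c a * S.errorPart W k m a ω

theorem mean_eq_estimatePart (hW : S.KroneckerErrorModel P W) (k : Fin K) (m : Fin d) :
    S.mean P W k m = S.estimatePart k m := by
  have hZ := S.isCircularGaussianVector_errorPart hW k m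
  funext a
  simp only [mean, X_eq_errorPart_add_estimatePart]
  rw [integral_add ((hZ.memLp a).integrable one_le_two) (integrable_const _),
    hZ.integral_eq_zero, integral_const]
  simp

theorem cov_eq (hW : S.KroneckerErrorModel P W) (k : Fin K) (m : Fin d) :
    S.cov P W k m =
      Matrix.of fun a b => ∫ ω, S.errorPart W k m a ω * star (S.errorPart W k m b ω) ∂P := by
  simp only [cov, S.mean_eq_estimatePart hW, X_eq_errorPart_add_estimatePart, add_sub_cancel_right]

end InterferenceChannel

theorem theorem1 {K d Nt Nr : ℕ} (S : InterferenceChannel K d Nt Nr)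
    (hbeams : S.NormalizedBeams)
    (hSigmat : S.Sigmat.PosSemidef) (hSigmar : S.Sigmar.PosSemidef)
    (hnoise : 0 < S.noiseVar)
    {Ω : Type*} [MeasurableSpace Ω] (P : Measure Ω) [IsProbabilityMeasure P]
    (W : Fin K → Fin K → Ω → Matrix (Fin Nr) (Fin Nt) ℂ)
    (hW : S.KroneckerErrorModel P W)
    (k : Fin K) (m : Fin d) (R : ℝ) (hR : 0 < R)
    (hτ : 0 ≤ S.tau k m R)
    (hcov : (S.cov P W k m).det ≠ 0)
    (Ψ : Matrix (Fin K × Fin d) (Fin K × Fin d) ℂ)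
    (hΨ : Ψ ∈ Matrix.unitaryGroup (Fin K × Fin d) ℂ)
    (Λ : Fin K × Fin d → ℝ)
    (hdecomp : S.cov P W k m = Ψ * Matrix.diagonal (fun a => (Λ a : ℂ)) * Ψᴴ)
    (χ : Fin K × Fin d → ℂ)
    (hχ : χ = OutageSeries.chi Ψ Λ (S.mean P W k m)) :
    (∀ l ∈ OutageSeries.distinct Λ,
      Summable (OutageSeries.term (S.tau k m R) Λ χ l)) ∧
    (S.outageProb P W k m R : ℂ) =
      -∑ l ∈ OutageSeries.distinct Λ,
        Complex.exp (-(S.tau k m R / l + OutageSeries.energy Λ χ l)) /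
            (l : ℂ) ^ OutageSeries.mult Λ l *
          ∑' r : ℕ, OutageSeries.term (S.tau k m R) Λ χ l r := by
  -- Without an index the transform would be constantly 1 and would not vanish at infinity.
  have : Nonempty (Fin K × Fin d) := ⟨(k, m)⟩
  have hZ := S.isCircularGaussianVector_errorPart hW k m
  rw [S.cov_eq hW] at hcov hdecomp
  obtain ⟨hΛ, hchar⟩ := OutageSeries.charFun_sum_norm_sq hZ (S.mean P W k m) hΨ hdecomp hcov
  have hm : AEMeasurable
      (fun ω => ∑ a, ‖S.errorPart W k m a ω + S.mean P W k m a‖ ^ 2) P :=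
    Finset.aemeasurable_fun_sum _ fun a _ =>
      (((hZ.memLp a).aestronglyMeasurable.aemeasurable.add_const _).norm).pow_const 2
  -- The outage event becomes the closed tail of the squared norm of error part plus mean, the mean
  -- being the estimate part.
  have hprob : S.outageProb P W k m R = (P.map fun ω =>
      ∑ a, ‖S.errorPart W k m a ω + S.mean P W k m a‖ ^ 2).real (Set.Ici (S.tau k m R)) := by
    rw [InterferenceChannel.outageProb, Measure.real, Measure.real,
      Measure.map_apply_of_aemeasurable hm measurableSet_Ici]
    congr 2
    ext ω
    rw [Set.mem_ofPred_eq, S.logb_one_add_sinr_le_iff hnoise W k m hR, Set.mem_preimage,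
      Set.mem_Ici, S.mean_eq_estimatePart hW]
    simp only [InterferenceChannel.X_eq_errorPart_add_estimatePart]
  rw [hprob, hχ]
  exact OutageSeries.measureReal_Ici_eq hΛ _ hchar hτ
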